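/- **Notation.** For real matrices $U^{(j)}$ of size $n_j\times R$ ($j=1,\dots,\ell$), with $r$-th columns $U^{(j)}_r$, write $[U^{(1)}\,\cdots\,U^{(\ell)}]=\sum_{r=1}^R U^{(1)}_r\otimes\cdots\otimes U^{(\ell)}_r\in\mathbb R^{n_1\times\cdots\times n_\ell}$. A matrix is $\rho$-bounded if each of its columns has Euclidean length at most $\rho$. For $\tau>0$, the $\tau$-robust Kruskal rank $\operatorname{K\text{-}rank}_\tau(A)$ of a real $n\times R$ matrix $A$ is the largest $k\le R$ such that every $n\times k$ submatrix formed by $k$ columns of $A$ has $k$-th largest singular value at least $1/\tau$ (and $0$ if there is no such $k\ge1$). $\|\cdot\|_F$ is the Frobenius norm of matrices and tensors (square root of the sum of the squares of the entries). **Theorem (uniqueness of decompositions for higher orders).** There is an absolute constant $C$ with the following property. Let $\ell\le R$, let $\tau_j,\rho_j,\rho'_j\ge 1$ be real numbers for $j\in[\ell]$, and let $T=[U^{(1)}\,\cdots\,U^{(\ell)}]$, where for every $j\in[\ell]$ the real $n_j\times R$ matrix $U^{(j)}$ is $\rho_j$-bounded, with $\operatorname{K\text{-}rank}_{\tau_j}(U^{(j)})=k_j\ge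 2$, and $$\sum_{j=1}^{\ell}k_j\ \ge\ 2R+\ell-1 .$$ Let $0<\varepsilon'<1$ and set $$\varepsilon=\Big(\frac{\varepsilon'}{R}\Big)^{2^{\ell}}\prod_{j=1}^{\ell}\big(\tau_j\,\rho_j\,\rho'_j\,n_j\big)^{-C}.$$ Then for all real $n_j\times R$ matrices $V^{(j)}$ that are $\rho'_j$-bounded ($j\in[\ell]$) and satisfy $\big\|T-[V^{(1)}\,\cdots\,V^{(\ell)}]\big\|_F\le\varepsilon$, there are an $R\times R$ permutation matrix $\Pi$ and real diagonal $R\times R$ matrices $\Lambda^{(1)},\dots,\Lambda^{(\ell)}$ such that $$\Big\|\prod_{j\in[\ell]}\Lambda^{(j)}-I\Big\|_F\le\varepsilon'\qquad\text{and}\qquad \big\|V^{(j)}-U^{(j)}\,\Pi\,\Lambda^{(j)}\big\|_F\le\varepsilon'\quad\text{for all } j\in[\ell].$$ -/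

import Mathlib

open scoped Matrix.Norms.Frobenius

/-- The tensor `[U⁽¹⁾ ⋯ U⁽ˡ⁾] = ∑ r, U⁽¹⁾_r ⊗ ⋯ ⊗ U⁽ˡ⁾_r`, as an `n₁ × ⋯ × nₗ` array of reals.
The norm of `EuclideanSpace` on such arrays is the Frobenius norm. -/
noncomputable def cpTensor {ℓ R : ℕ} {n : Fin ℓ → ℕ}
    (U : ∀ j, Matrix (Fin (n j)) (Fin R) ℝ) : EuclideanSpace ℝ (∀ j, Fin (n j)) :=
  WithLp.toLp 2 fun i => ∑ r, ∏ j, U j (i j) r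

/-- Two tensors are `ε`-close if their difference has Frobenius norm at most `ε`. -/
def TensorClose {ℓ : ℕ} {n : Fin ℓ → ℕ} (ε : ℝ)
    (S T : EuclideanSpace ℝ (∀ j, Fin (n j))) : Prop :=
  ‖S - T‖ ≤ ε

/-- A matrix is `ρ`-bounded if each of its columns has Euclidean length at most `ρ`. -/
def ColBounded {m ι : Type*} [Fintype m] (ρ : ℝ) (A : Matrix m ι ℝ) : Prop :=
  ∀ r, ‖WithLp.toLp 2 (A.col r)‖ ≤ ρ

/-- `sigmaMat k A` is the `k`-th largest singular value of `A`, for `k ≥ 1`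
(`LinearMap.singularValues` is indexed from `0`). -/
noncomputable def sigmaMat {m ι : Type*} [Fintype m] [Fintype ι] [DecidableEq ι]
    (k : ℕ) (A : Matrix m ι ℝ) : ℝ :=
  (Matrix.toEuclideanLin A).singularValues (k - 1)

/-- The submatrix formed by the columns with index in `S`. -/
def colSubmatrix {m ι : Type*} (A : Matrix m ι ℝ) (S : Finset ι) : Matrix m S ℝ :=
  A.submatrix id Subtype.val

/-- The `τ`-robust Kruskal rank: the largest `k`, at most the number of columns, such that every
submatrix formed by `k` of the columns has `k`-th singular value at least `1 / τ`
(and `0` if there is no such `k ≥ 1`). -/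
noncomputable def robustKruskalRank {m ι : Type*} [Fintype m] [Fintype ι] [DecidableEq ι]
    (τ : ℝ) (A : Matrix m ι ℝ) : ℕ :=
  sSup {k : ℕ | k ≤ Fintype.card ι ∧
    ∀ S : Finset ι, S.card = k → 1 / τ ≤ sigmaMat k (colSubmatrix A S)}

open scoped RealInnerProductSpace

/-! The statement reduces to three factors. Products of vectors dual to the columns of the separate
factors are dual to the columns of a Khatri–Rao product, so grouping a set of factors gives Kruskal
rank at least min(R, 1 + ∑ (k_j - 1)). Since ∑ (k_j - 1) ≥ 2R - 1, the factors split into three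
groups whose ranks satisfy Kruskal's condition a + b + c ≥ 2R + 2 (`DualSep.elemTensor`,
`exists_coloring`). Robust Kruskal rank is turned into bounded dual vectors by
`dualSep_of_robustKruskalRank`.

For three factors let a be the largest rank and m = R + 1 - a. Projecting away the `A' s` with s
outside an m-set S leaves, up to a small error, exactly m of the `A i`, indexed by a set X
(`exists_survives`). Comparing the projected tensors puts the m vectors `B i`, i ∈ X, near the span
of the m vectors `B' s`, s ∈ S, and hence conversely; the same X serves for C. Intersecting the sets
X over all S containing p gives a set `I p` such that `B' p` and `C' p` lie near the spans it
indexes. As m + 1 of the `B' s` cannot all lie near the span of m of the `B i`, counting forces the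
`I p` to be singletons forming a permutation (`exists_perm_of_finsets`). So `B' p` and `C' p` are
nearly multiples of `B (π p)` and `C (π p)`, and dual test vectors then show that matched rank-one
terms are close (`exists_perm_term_close`).

Finally, close rank-one tensors have nearly proportional factors, with scalars of product near 1
(`exists_scaling_of_prod_inner_close`). All errors are ε times powers of K = ∏ τ_j ρ_j ρ'_j n_j, and
K ≥ 2R absorbs the number of terms and the numerical factors. -/

/-! ### Normalized linear relations and dual vectors -/

theorem exists_normalized_relation {ι κ : Type*} [Fintype ι] [DecidableEq ι]
    (K : Finset ι) (S : Finset κ) (h : S.card < K.card) (f : ι → κ → ℝ) :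
    ∃ c : ι → ℝ, (∀ i ∉ K, c i = 0) ∧ (∀ i, |c i| ≤ 1) ∧ (∃ r ∈ K, c r = 1) ∧
      ∀ s ∈ S, ∑ i, c i * f i s = 0 := by
  classical
  have hker : ¬ Function.Injective (Matrix.of fun (s : S) (i : K) => f i s).mulVecLin := by
    intro hinj
    have := LinearMap.finrank_le_finrank_of_injective hinj
    simp at this
    omega
  have h1 := hker
  rw [← LinearMap.ker_eq_bot] at h1
  obtain ⟨g, hg, hg0⟩ := (Submodule.ne_bot_iff _).1 h1
  obtain ⟨j, hj⟩ : ∃ j, g j ≠ 0 := by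
    by_contra! hcon
    exact hg0 (funext hcon)
  -- Dividing by the entry of largest modulus gives one coefficient 1 and all others at most 1 in
  -- modulus.
  obtain ⟨m, -, hm⟩ := Finset.exists_max_image Finset.univ (fun i => |g i|) ⟨j, Finset.mem_univ j⟩
  have hm0 : g m ≠ 0 := by
    have := hm j (Finset.mem_univ j)
    have h2 := abs_pos.2 hj
    exact abs_pos.1 (h2.trans_le this)
  refine ⟨fun i => if hi : i ∈ K then g ⟨i, hi⟩ / g m else 0, ?_, ?_, ⟨m, m.2, ?_⟩, ?_⟩
  · intro i hi
    simp [hi]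
  · intro i
    by_cases hi : i ∈ K
    · simp only [hi, dif_pos, abs_div]
      exact div_le_one_of_le₀ (hm _ (Finset.mem_univ _)) (abs_nonneg _)
    · simp [hi]
  · simp [hm0]
  · intro s hs
    have h3 := congrFun (LinearMap.mem_ker.1 hg) ⟨s, hs⟩
    simp only [Matrix.mulVecLin_apply, Matrix.mulVec, dotProduct, Matrix.of_apply,
      Pi.zero_apply] at h3
    have h4 : ∑ i, (if hi : i ∈ K then g ⟨i, hi⟩ / g m else 0) * f i s
        = ∑ i : K, g i / g m * f i s := by
      rw [← Finset.sum_subset (Finset.subset_univ K), ← Finset.sum_coe_sort K]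
      · refine Finset.sum_congr rfl fun i _ => ?_
        simp
      · intro i _ hi
        simp [hi]
    rw [h4]
    have h5 : ∑ i : K, g i / g m * f i s = (∑ i : K, f i s * g i) / g m := by
      rw [Finset.sum_div]
      refine Finset.sum_congr rfl fun i _ => by ring
    rw [h5, h3, zero_div]

/-- Every `A r` can be separated from any fewer than `k` other members of the family by a dual
vector of norm at most `τ`. -/
def DualSep {ι E : Type*} [NormedAddCommGroup E] [InnerProductSpace ℝ E]
    (k : ℕ) (τ : ℝ) (A : ι → E) : Prop :=
  ∀ (r : ι) (Z : Finset ι), r ∉ Z → Z.card < k →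
    ∃ y : E, ‖y‖ ≤ τ ∧ ⟪y, A r⟫ = 1 ∧ ∀ s ∈ Z, ⟪y, A s⟫ = 0

theorem DualSep.abs_coeff_le {ι E : Type*} [Fintype ι] [DecidableEq ι] [NormedAddCommGroup E]
    [InnerProductSpace ℝ E] {k : ℕ} {τ : ℝ} {A : ι → E} (h : DualSep k τ A)
    {c : ι → ℝ} {K : Finset ι} (hK : K.card ≤ k) (hc : ∀ i ∉ K, c i = 0) {r : ι} (hr : r ∈ K) :
    |c r| ≤ τ * ‖∑ i, c i • A i‖ := by
  obtain ⟨y, hy, hyr, hy0⟩ := h r (K.erase r) (by simp)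
    (by rw [Finset.card_erase_of_mem hr]; have := Finset.card_pos.2 ⟨r, hr⟩; omega)
  have h1 : ⟪y, ∑ i, c i • A i⟫ = c r := by
    rw [inner_sum, Finset.sum_eq_single r]
    · rw [inner_smul_right, hyr, mul_one]
    · intro i _ hi
      rw [inner_smul_right]
      by_cases hiK : i ∈ K
      · rw [hy0 i (Finset.mem_erase.2 ⟨hi, hiK⟩), mul_zero]
      · rw [hc i hiK, zero_mul]
    · simp
  rw [← h1]
  exact (abs_real_inner_le_norm _ _).trans (mul_le_mul_of_nonneg_right hy (norm_nonneg _))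

theorem norm_sum_smul_le_card_mul {ι E : Type*} [Fintype ι] [NormedAddCommGroup E]
    [NormedSpace ℝ E] {c : ι → ℝ} {v : ι → E} {M N : ℝ} (hN : 0 ≤ N)
    (hc : ∀ i, |c i| ≤ M) (hv : ∀ i, c i ≠ 0 → ‖v i‖ ≤ N) :
    ‖∑ i, c i • v i‖ ≤ Fintype.card ι * (M * N) := by
  refine (norm_sum_le _ _).trans ?_
  refine (Finset.sum_le_card_nsmul _ _ (M * N) fun i _ => ?_).trans_eq (by simp)
  rw [norm_smul, Real.norm_eq_abs]
  have hM : 0 ≤ M := (abs_nonneg _).trans (hc i)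
  by_cases h0 : c i = 0
  · rw [h0, abs_zero, zero_mul]; positivity
  · exact mul_le_mul (hc i) (hv i h0) (norm_nonneg _) hM

theorem Finset.exists_union_card_le {ι : Type*} [DecidableEq ι] (W : Finset ι) {b c : ℕ}
    (h : W.card ≤ b + c) :
    ∃ Z₁ Z₂ : Finset ι, W = Z₁ ∪ Z₂ ∧ Z₁.card ≤ b ∧ Z₂.card ≤ c := by
  obtain ⟨Z, hZ, hcard⟩ := Finset.exists_subset_card_eq (min_le_left W.card b)
  refine ⟨Z, W \ Z, (Finset.union_sdiff_of_subset hZ).symm, by omega, ?_⟩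
  rw [Finset.card_sdiff_of_subset hZ]
  omega

/-! ### Three factors: the components that survive a projection -/

/-- Two families of `R` rank-one terms with `ε`-close sums (in the spectral norm of trilinear
forms), where the first family satisfies a quantitative Kruskal condition, the factors `A` having
the largest Kruskal rank. All the parameters are bounded by `K`. -/
structure KruskalClose {R : ℕ} {E F G : Type*}
    [NormedAddCommGroup E] [InnerProductSpace ℝ E] [NormedAddCommGroup F] [InnerProductSpace ℝ F]
    [NormedAddCommGroup G] [InnerProductSpace ℝ G] (K ε : ℝ) (a b c : ℕ)
    (A A' : Fin R → E) (B B' : Fin R → F) (C C' : Fin R → G) : Prop where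
  one_le : 1 ≤ K
  R_le : (R : ℝ) ≤ K
  eps_nonneg : 0 ≤ ε
  small : 84 * ε * K ^ 22 < 1
  sepA : DualSep a K A
  sepB : DualSep b K B
  sepC : DualSep c K C
  normA : ∀ r, ‖A r‖ ≤ K
  normB : ∀ r, ‖B r‖ ≤ K
  normC : ∀ r, ‖C r‖ ≤ K
  normA' : ∀ r, ‖A' r‖ ≤ K
  normB' : ∀ r, ‖B' r‖ ≤ K
  normC' : ∀ r, ‖C' r‖ ≤ K
  a_le : a ≤ R
  b_le : b ≤ a
  c_le : c ≤ a
  sum_ge : 2 * R + 2 ≤ a + b + c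
  close : ∀ x y z, |∑ r, ⟪x, A r⟫ * ⟪y, B r⟫ * ⟪z, C r⟫
    - ∑ r, ⟪x, A' r⟫ * ⟪y, B' r⟫ * ⟪z, C' r⟫| ≤ ε * (‖x‖ * ‖y‖ * ‖z‖)

namespace KruskalClose

variable {R : ℕ} {E F G : Type*}
    [NormedAddCommGroup E] [InnerProductSpace ℝ E] [NormedAddCommGroup F] [InnerProductSpace ℝ F]
    [NormedAddCommGroup G] [InnerProductSpace ℝ G] {K ε : ℝ} {a b c : ℕ}
    {A A' : Fin R → E} {B B' : Fin R → F} {C C' : Fin R → G}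

theorem swap (h : KruskalClose K ε a b c A A' B B' C C') :
    KruskalClose K ε a c b A A' C C' B B' where
  one_le := h.one_le
  R_le := h.R_le
  eps_nonneg := h.eps_nonneg
  small := h.small
  sepA := h.sepA
  sepB := h.sepC
  sepC := h.sepB
  normA := h.normA
  normB := h.normC
  normC := h.normB
  normA' := h.normA'
  normB' := h.normC'
  normC' := h.normB'
  a_le := h.a_le
  b_le := h.c_le
  c_le := h.b_le
  sum_ge := by have := h.sum_ge; omega
  close x y z := by
    have := h.close x z y
    simp only [mul_right_comm _ ⟪y, _⟫]
    rwa [mul_right_comm ‖x‖]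

theorem K_pos (h : KruskalClose K ε a b c A A' B B' C C') : 0 < K := one_pos.trans_le h.one_le

theorem eps_mul_pow_le (h : KruskalClose K ε a b c A A' B B' C C') {m : ℕ} (hm : m ≤ 22) :
    84 * (ε * K ^ m) < 1 := by
  refine lt_of_le_of_lt ?_ h.small
  rw [← mul_assoc]
  exact mul_le_mul_of_nonneg_left (pow_le_pow_right₀ h.one_le hm)
    (mul_nonneg (by norm_num) h.eps_nonneg)

/-- On vectors x orthogonal to the `A' s`, s ∉ S, the second tensor has only |S| terms, so it cannot
match |T| = |S| + 1 robustly independent terms of the first. Concretely, a combination Y of vectors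
dual to the `B i`, i ∈ T, annihilates the second tensor, while a z dual to `C r` isolates a single
term of the first. -/
theorem exists_inner_le (h : KruskalClose K ε a b c A A' B B' C C') {S T : Finset (Fin R)}
    (hS : S.card + a = R + 1) (hT : T.card + a = R + 2) :
    ∃ r ∈ T, ∀ x, (∀ s ∉ S, ⟪x, A' s⟫ = 0) → |⟪x, A r⟫| ≤ ε * K ^ 3 * ‖x‖ := by
  have hs := h.sum_ge
  have ha := h.a_le
  have hb := h.b_le
  have hc := h.c_le
  have hK := h.K_pos
  -- The a - 2 indices outside T are shared between y and z. Each must also separate inside T, so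
  -- there is room for (b - |T|) + (c - |T|) of them, enough exactly when a + b + c ≥ 2R + 2.
  obtain ⟨Z₁, Z₂, hZ, hZ₁, hZ₂⟩ := Tᶜ.exists_union_card_le (b := b - T.card) (c := c - T.card)
    (by rw [Finset.card_compl, Fintype.card_fin]; omega)
  have hy : ∀ r ∈ T, ∃ y : F, ‖y‖ ≤ K ∧ ⟪y, B r⟫ = 1 ∧ ∀ s ∈ T.erase r ∪ Z₁, ⟪y, B s⟫ = 0 := by
    intro r hr
    refine h.sepB r _ ?_ ?_
    · have : r ∉ Z₁ := fun hr' => by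
        have : r ∈ Tᶜ := hZ ▸ Finset.mem_union_left _ hr'
        exact Finset.mem_compl.1 this hr
      simp [this]
    · have := Finset.card_union_le (T.erase r) Z₁
      rw [Finset.card_erase_of_mem hr] at this
      omega
  have hz : ∀ r ∈ T, ∃ z : G, ‖z‖ ≤ K ∧ ⟪z, C r⟫ = 1 ∧ ∀ s ∈ T.erase r ∪ Z₂, ⟪z, C s⟫ = 0 := by
    intro r hr
    refine h.sepC r _ ?_ ?_
    · have : r ∉ Z₂ := fun hr' => by
        have : r ∈ Tᶜ := hZ ▸ Finset.mem_union_right _ hr'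
        exact Finset.mem_compl.1 this hr
      simp [this]
    · have := Finset.card_union_le (T.erase r) Z₂
      rw [Finset.card_erase_of_mem hr] at this
      omega
  choose! y hyn hy1 hy0 using hy
  obtain ⟨g, hg0, hg1, ⟨r, hr, hgr⟩, hgS⟩ := exists_normalized_relation T S (by omega)
    (fun i s => ⟪y i, B' s⟫)
  obtain ⟨z, hzn, hz1, hz0⟩ := hz r hr
  set Y : F := ∑ i, g i • y i with hY
  have hYin : ∀ v, ⟪Y, v⟫ = ∑ i, g i * ⟪y i, v⟫ := by
    intro v
    simp only [hY, sum_inner, real_inner_smul_left]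
  have hYn : ‖Y‖ ≤ K * (1 * K) := by
    refine (norm_sum_smul_le_card_mul hK.le hg1 (N := K) fun i hi => hyn i ?_).trans ?_
    · by_contra hiT
      exact hi (hg0 i hiT)
    · rw [Fintype.card_fin]
      exact mul_le_mul_of_nonneg_right h.R_le (by positivity)
  refine ⟨r, hr, fun x hx => ?_⟩
  have h1 := h.close x Y z
  have h2 : ∑ s, ⟪x, A' s⟫ * ⟪Y, B' s⟫ * ⟪z, C' s⟫ = 0 := by
    refine Finset.sum_eq_zero fun s _ => ?_
    by_cases hsS : s ∈ S
    · rw [hYin, hgS s hsS, mul_zero, zero_mul]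
    · rw [hx s hsS, zero_mul, zero_mul]
  have h3 : ∑ s, ⟪x, A s⟫ * ⟪Y, B s⟫ * ⟪z, C s⟫ = ⟪x, A r⟫ := by
    rw [Finset.sum_eq_single r]
    · have : ⟪Y, B r⟫ = 1 := by
        rw [hYin, Finset.sum_eq_single r]
        · rw [hgr, hy1 r hr, one_mul]
        · intro i _ hir
          by_cases hiT : i ∈ T
          · rw [hy0 i hiT r (Finset.mem_union_left _ (Finset.mem_erase.2 ⟨hir.symm, hr⟩)), mul_zero]
          · rw [hg0 i hiT, zero_mul]
        · simp
      rw [this, hz1, mul_one, mul_one]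
    · intro i _ hir
      by_cases hiT : i ∈ T
      · rw [hz0 i (Finset.mem_union_left _ (Finset.mem_erase.2 ⟨hir, hiT⟩)), mul_zero]
      · have : i ∈ Z₁ ∪ Z₂ := hZ ▸ Finset.mem_compl.2 hiT
        rcases Finset.mem_union.1 this with hi | hi
        · have : ⟪Y, B i⟫ = 0 := by
            rw [hYin]
            refine Finset.sum_eq_zero fun j _ => ?_
            by_cases hjT : j ∈ T
            · rw [hy0 j hjT i (Finset.mem_union_right _ hi), mul_zero]
            · rw [hg0 j hjT, zero_mul]
          rw [this, mul_zero, zero_mul]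
        · rw [hz0 i (Finset.mem_union_right _ hi), mul_zero]
    · simp
  rw [h2, h3, sub_zero] at h1
  refine h1.trans ?_
  have : ‖x‖ * ‖Y‖ * ‖z‖ ≤ ‖x‖ * (K * (1 * K)) * K := by gcongr
  calc ε * (‖x‖ * ‖Y‖ * ‖z‖) ≤ ε * (‖x‖ * (K * (1 * K)) * K) :=
        mul_le_mul_of_nonneg_left this h.eps_nonneg
    _ = _ := by ring

/-- `X` is the set of components whose `A`-factors survive the orthogonal projection that kills
the factors of the second family outside `S`; the projected factors are `w`. -/
def Survives (_ : KruskalClose K ε a b c A A' B B' C C') (S X : Finset (Fin R)) (w : Fin R → E) :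
    Prop :=
  (∀ i, ∀ s ∉ S, ⟪w i, A' s⟫ = 0) ∧
  (∀ i x, (∀ s ∉ S, ⟪x, A' s⟫ = 0) → ⟪x, A i⟫ = ⟪x, w i⟫) ∧
  (∀ i ∈ X, 1 ≤ K ^ 2 * ‖w i‖) ∧ (∀ i ∉ X, ‖w i‖ ≤ ε * K ^ 3)

/-- X is cut out by the threshold 1/K² on the projected norms. Both inequalities for its size are
dimension counts, and its maximality produces the gap between 1/K² and εK³. -/
theorem exists_survives (h : KruskalClose K ε a b c A A' B B' C C') {S : Finset (Fin R)}
    (hS : S.card + a = R + 1) : ∃ X w, X.card + a = R + 1 ∧ h.Survives S X w := by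
  classical
  have hs := h.sum_ge
  have ha := h.a_le
  have hb := h.b_le
  have hc := h.c_le
  have hK := h.K_pos
  let W : Submodule ℝ E := Submodule.span ℝ (Set.range fun s : {s // s ∉ S} => A' s)
  have : FiniteDimensional ℝ W := FiniteDimensional.span_of_finite ℝ (Set.finite_range _)
  let w : Fin R → E := fun i => A i - W.starProjection (A i)
  have hperp : ∀ x, (∀ s ∉ S, ⟪x, A' s⟫ = 0) ↔ x ∈ Wᗮ := by
    intro x
    constructor
    · intro hx
      rw [Submodule.mem_orthogonal']
      intro u hu
      induction hu using Submodule.span_induction with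
      | mem u hu => obtain ⟨s, rfl⟩ := hu; exact hx s s.2
      | zero => simp
      | add u v _ _ hu hv => rw [inner_add_right, hu, hv, add_zero]
      | smul t u _ hu => rw [inner_smul_right, hu, mul_zero]
    · intro hx s hs
      have hm : A' s ∈ W := Submodule.subset_span ⟨⟨s, hs⟩, rfl⟩
      exact Submodule.inner_left_of_mem_orthogonal hm hx
  have hw1 : ∀ i, ∀ s ∉ S, ⟪w i, A' s⟫ = 0 := fun i =>
    (hperp _).2 (W.sub_starProjection_mem_orthogonal (A i))
  have hw2 : ∀ i x, (∀ s ∉ S, ⟪x, A' s⟫ = 0) → ⟪x, A i⟫ = ⟪x, w i⟫ := by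
    intro i x hx
    rw [inner_sub_right, Submodule.inner_left_of_mem_orthogonal (W.starProjection_apply_mem (A i))
      ((hperp x).1 hx), sub_zero]
  let X : Finset (Fin R) := Finset.univ.filter fun i => 1 ≤ K ^ 2 * ‖w i‖
  have hsmall : ∀ r, (∀ x, (∀ s ∉ S, ⟪x, A' s⟫ = 0) → |⟪x, A r⟫| ≤ ε * K ^ 3 * ‖x‖) →
      ‖w r‖ ≤ ε * K ^ 3 := by
    intro r hr
    have h1 := hr (w r) (hw1 r)
    rw [hw2 r _ (hw1 r), real_inner_self_eq_norm_sq, abs_of_nonneg (sq_nonneg _), sq] at h1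
    rcases (norm_nonneg (w r)).eq_or_lt with h0 | h0
    · rw [← h0]; have := h.eps_nonneg; positivity
    · exact le_of_mul_le_mul_right h1 h0
  have hnotX : ∀ r, ‖w r‖ ≤ ε * K ^ 3 → r ∉ X := by
    intro r hr hrX
    have h1 : 1 ≤ K ^ 2 * ‖w r‖ := (Finset.mem_filter.1 hrX).2
    have h2 : K ^ 2 * ‖w r‖ ≤ K ^ 2 * (ε * K ^ 3) := by gcongr
    have h3 := h.eps_mul_pow_le (m := 5) (by norm_num)
    have : K ^ 2 * (ε * K ^ 3) = ε * K ^ 5 := by ring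
    linarith
  have hle : X.card + a ≤ R + 1 := by
    by_contra hcon
    obtain ⟨T, hTX, hT⟩ := Finset.exists_subset_card_eq (show R + 2 - a ≤ X.card by omega)
    obtain ⟨r, hrT, hr⟩ := h.exists_inner_le (T := T) hS (by omega)
    exact hnotX r (hsmall r hr) (hTX hrT)
  have hge : R + 1 ≤ X.card + a := by
    by_contra hcon
    -- With too few survivors, a of the discarded `A i` have a combination x orthogonal to the a - 1
    -- vectors `A' s`, s ∉ S. Separation gives ‖x‖ ≥ 1/K, whereas projected norms below 1/K² make
    -- ‖x‖ < R/K² ≤ 1/K.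
    have hXc : a ≤ Xᶜ.card := by rw [Finset.card_compl, Fintype.card_fin]; omega
    obtain ⟨T, hTX, hT⟩ := Finset.exists_subset_card_eq hXc
    obtain ⟨g, hg0, hg1, ⟨r, hr, hgr⟩, hgS⟩ := exists_normalized_relation T Sᶜ
      (by rw [Finset.card_compl, Fintype.card_fin]; omega) (fun i s => ⟪A i, A' s⟫)
    set x : E := ∑ i, g i • A i with hx
    have hxS : ∀ s ∉ S, ⟪x, A' s⟫ = 0 := by
      intro s hs
      rw [hx, sum_inner, ← hgS s (Finset.mem_compl.2 hs)]
      simp only [real_inner_smul_left]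
    have h1 : 1 ≤ K * ‖x‖ := by
      have := h.sepA.abs_coeff_le hT.le hg0 hr
      rwa [hgr, abs_one] at this
    have h2 : ‖x‖ ^ 2 = ∑ i, g i * ⟪x, w i⟫ := by
      rw [← real_inner_self_eq_norm_sq]
      nth_rewrite 2 [hx]
      rw [inner_sum]
      refine Finset.sum_congr rfl fun i _ => ?_
      rw [inner_smul_right, hw2 i x hxS]
    have hxpos : 0 < ‖x‖ := by
      by_contra hcon
      have : ‖x‖ = 0 := le_antisymm (not_lt.1 hcon) (norm_nonneg _)
      rw [this, mul_zero] at h1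
      linarith
    have h3 : K ^ 2 * ‖x‖ ^ 2 < R * ‖x‖ := by
      rw [h2, Finset.mul_sum]
      have hRsum : (R : ℝ) * ‖x‖ = ∑ _i : Fin R, ‖x‖ := by simp
      rw [hRsum]
      have hterm : ∀ i, g i ≠ 0 → K ^ 2 * (g i * ⟪x, w i⟫) < ‖x‖ := by
        intro i hi
        have hiT : i ∈ T := by
          by_contra hiT
          exact hi (hg0 i hiT)
        have hiX : K ^ 2 * ‖w i‖ < 1 := by
          have := Finset.mem_compl.1 (hTX hiT)
          simpa [X] using this
        calc K ^ 2 * (g i * ⟪x, w i⟫) ≤ K ^ 2 * (1 * (‖x‖ * ‖w i‖)) := by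
              refine mul_le_mul_of_nonneg_left ?_ (sq_nonneg K)
              calc g i * ⟪x, w i⟫ ≤ |g i * ⟪x, w i⟫| := le_abs_self _
                _ = |g i| * |⟪x, w i⟫| := abs_mul _ _
                _ ≤ _ := mul_le_mul (hg1 i) (abs_real_inner_le_norm _ _) (abs_nonneg _) zero_le_one
          _ = ‖x‖ * (K ^ 2 * ‖w i‖) := by ring
          _ < ‖x‖ * 1 := by gcongr
          _ = ‖x‖ := mul_one _
      refine Finset.sum_lt_sum (fun i _ => ?_) ⟨r, Finset.mem_univ r, hterm r (by rw [hgr]; simp)⟩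
      by_cases hi : g i = 0
      · rw [hi]; simp
      · exact (hterm i hi).le
    have h4 : K ^ 2 * ‖x‖ < R := by
      have : K ^ 2 * ‖x‖ * ‖x‖ < R * ‖x‖ := by rw [mul_assoc, ← sq]; exact h3
      exact lt_of_mul_lt_mul_right this hxpos.le
    have h5 := h.R_le
    nlinarith
  refine ⟨X, w, le_antisymm hle hge, hw1, hw2, fun i hi => (Finset.mem_filter.1 hi).2, ?_⟩
  intro i hi
  -- Among X and i some member has projected norm at most εK³; this is below the threshold, so the
  -- member is i.
  obtain ⟨r, hrT, hr⟩ := h.exists_inner_le (T := insert i X) hS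
    (by rw [Finset.card_insert_of_notMem hi]; omega)
  rcases Finset.mem_insert.1 hrT with rfl | hrX
  · exact hsmall _ hr
  · exact absurd hrX (hnotX r (hsmall r hr))

end KruskalClose

/-! ### Vectors near the span of a subfamily -/

/-- `v` is within `η` of a linear combination of the vectors `B i` with `i ∈ X`. -/
def NearSpan {ι F : Type*} [Fintype ι] [NormedAddCommGroup F] [InnerProductSpace ℝ F]
    (B : ι → F) (X : Finset ι) (η : ℝ) (v : F) : Prop :=
  ∃ g : ι → ℝ, (∀ i ∉ X, g i = 0) ∧ ‖v - ∑ i, g i • B i‖ ≤ η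

theorem NearSpan.mono {ι F : Type*} [Fintype ι] [NormedAddCommGroup F] [InnerProductSpace ℝ F]
    {B : ι → F} {X Y : Finset ι} {η θ : ℝ} {v : F} (h : NearSpan B X η v) (hXY : X ⊆ Y)
    (hη : η ≤ θ) : NearSpan B Y θ v := by
  obtain ⟨g, hg, hv⟩ := h
  exact ⟨g, fun i hi => hg i fun hX => hi (hXY hX), hv.trans hη⟩

/-- The coefficient rows of the `B r`, r ∈ X, together with the unit row at s are |S| + 1 vectors in
|S| coordinates. A relation among them becomes an approximate relation between `B' s` and the `B r`.
Separation of B keeps the coefficient of `B' s` away from 0, so the relation can be solved for `B'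
s`. -/
theorem NearSpan.reverse {ι F : Type*} [Fintype ι] [DecidableEq ι] [NormedAddCommGroup F]
    [InnerProductSpace ℝ F] {B B' : ι → F} {X S : Finset ι} {η K : ℝ} {b : ℕ}
    (hK : 1 ≤ K) (hcard : (Fintype.card ι : ℝ) ≤ K) (hsep : DualSep b K B)
    (hB' : ∀ s, ‖B' s‖ ≤ K) (hXS : X.card = S.card) (hXb : X.card ≤ b) (hη : 2 * K ^ 2 * η ≤ 1)
    (hη0 : 0 ≤ η)
    (h : ∀ r ∈ X, NearSpan B' S η (B r)) {s : ι} (hs : s ∈ S) :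
    NearSpan B X (2 * K ^ 3 * η) (B' s) := by
  classical
  have hKpos : 0 < K := one_pos.trans_le hK
  choose! g hg0 hgn using h
  obtain ⟨d, hd0, hd1, ⟨q, hq, hdq⟩, hdS⟩ := exists_normalized_relation (Finset.insertNone X) S
    (by rw [Finset.card_insertNone]; omega)
    (fun o t => o.elim (if t = s then (1 : ℝ) else 0) (fun r => g r t))
  have hd0' : ∀ r ∉ X, d (some r) = 0 := fun r hr => hd0 _ (by simpa using hr)
  set e : F := ∑ r, d (some r) • (B r - ∑ t, g r t • B' t) with he
  have hen : ‖e‖ ≤ K * (1 * η) := by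
    refine (norm_sum_smul_le_card_mul hη0 (fun r => hd1 (some r)) fun r hr => hgn r ?_).trans ?_
    · by_contra hrX
      exact hr (hd0' r hrX)
    · exact mul_le_mul_of_nonneg_right hcard (by positivity)
  have hrel : d none • B' s + ∑ r, d (some r) • B r = e := by
    have h1 : ∑ r, d (some r) • ∑ t, g r t • B' t = - (d none • B' s) := by
      have h2 : ∑ r, d (some r) • ∑ t, g r t • B' t
          = ∑ t, (∑ r, d (some r) * g r t) • B' t := by
        simp only [Finset.smul_sum, Finset.sum_smul, smul_smul]
        exact Finset.sum_comm
      rw [h2, Finset.sum_eq_single s]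
      · have := hdS s hs
        rw [Fintype.sum_option] at this
        simp only [Option.elim_none, Option.elim_some, if_true, mul_one] at this
        rw [← neg_smul]
        congr 1
        linarith
      · intro t _ hts
        by_cases htS : t ∈ S
        · have := hdS t htS
          rw [Fintype.sum_option] at this
          simp only [Option.elim_none, Option.elim_some, hts, if_false, mul_zero, zero_add] at this
          rw [this, zero_smul]
        · rw [Finset.sum_eq_zero, zero_smul]
          intro r _
          by_cases hrX : r ∈ X
          · rw [hg0 r hrX t htS, mul_zero]
          · rw [hd0' r hrX, zero_mul]
      · simp
    simp only [he, smul_sub, Finset.sum_sub_distrib, h1]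
    abel
  -- If the coefficient equal to 1 belongs to some `B r`, separation gives 1 ≤ K²(η + |d none|), and
  -- 2K²η ≤ 1 absorbs the first term.
  have hdn : 1 ≤ 2 * K ^ 2 * |d none| := by
    cases q with
    | none =>
      rw [hdq, abs_one]
      nlinarith
    | some r =>
      have hr : r ∈ X := by simpa using hq
      have h1 := hsep.abs_coeff_le (c := fun r => d (some r)) hXb hd0' hr
      simp only [hdq, abs_one] at h1
      have h2 : ∑ r, d (some r) • B r = e - d none • B' s := by rw [← hrel]; abel
      rw [h2] at h1
      have h3 : ‖e - d none • B' s‖ ≤ K * (1 * η) + |d none| * K := by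
        refine (norm_sub_le _ _).trans (add_le_add hen ?_)
        rw [norm_smul, Real.norm_eq_abs]
        exact mul_le_mul_of_nonneg_left (hB' s) (abs_nonneg _)
      have h4 : K * ‖e - d none • B' s‖ ≤ K * (K * (1 * η) + |d none| * K) := by gcongr
      nlinarith
  have hd_ne : d none ≠ 0 := by
    intro h0
    rw [h0, abs_zero, mul_zero] at hdn
    linarith
  refine ⟨fun r => - (d (some r) / d none), fun i hi => by simp [hd0' i hi], ?_⟩
  have h5 : B' s - ∑ r, (-(d (some r) / d none)) • B r = (d none)⁻¹ • e := by
    rw [← hrel, smul_add, smul_smul, inv_mul_cancel₀ hd_ne, one_smul, Finset.smul_sum]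
    simp only [neg_smul, Finset.sum_neg_distrib, sub_neg_eq_add, smul_smul]
    congr 1
    refine Finset.sum_congr rfl fun r _ => ?_
    rw [div_eq_inv_mul]
  rw [h5, norm_smul, norm_inv, Real.norm_eq_abs]
  have h6 : |d none|⁻¹ ≤ 2 * K ^ 2 := by
    rw [inv_le_iff_one_le_mul₀ (abs_pos.2 hd_ne)]
    exact hdn
  calc |d none|⁻¹ * ‖e‖ ≤ (2 * K ^ 2) * (K * (1 * η)) := by gcongr
    _ = _ := by ring

/-- Two approximate representations over sets of size at most b/2 involve at most b of the `B i`
together, so their coefficients nearly agree. Hence a coefficient at an index missing from one of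
the sets is small and can be dropped. -/
theorem NearSpan.inter {ι F : Type*} [Fintype ι] [DecidableEq ι] [NormedAddCommGroup F]
    [InnerProductSpace ℝ F] {B : ι → F} {I : Finset ι} {𝒳 : Set (Finset ι)} {η K : ℝ} {b : ℕ}
    {v : F} (hK : 1 ≤ K) (hcard : (Fintype.card ι : ℝ) ≤ K) (hsep : DualSep b K B)
    (hB : ∀ s, ‖B s‖ ≤ K) (hη0 : 0 ≤ η) (h𝒳b : ∀ X ∈ 𝒳, 2 * X.card ≤ b)
    (h𝒳 : 𝒳.Nonempty) (hnear : ∀ X ∈ 𝒳, NearSpan B X η v)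
    (hI : ∀ i ∉ I, ∃ X ∈ 𝒳, i ∉ X) :
    NearSpan B I (3 * K ^ 3 * η) v := by
  have hKpos : 0 < K := one_pos.trans_le hK
  obtain ⟨X₀, hX₀⟩ := h𝒳
  obtain ⟨g, hg0, hgn⟩ := hnear X₀ hX₀
  have hsmall : ∀ i ∉ I, |g i| ≤ 2 * K * η := by
    intro i hi
    obtain ⟨X, hX, hiX⟩ := hI i hi
    by_cases hiX₀ : i ∈ X₀
    · obtain ⟨g', hg'0, hg'n⟩ := hnear X hX
      have h1 := hsep.abs_coeff_le (c := fun j => g j - g' j) (K := X₀ ∪ X)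
        ((Finset.card_union_le _ _).trans (by have := h𝒳b _ hX; have := h𝒳b _ hX₀; omega))
        (fun j hj => by
          rw [Finset.mem_union, not_or] at hj
          simp [hg0 j hj.1, hg'0 j hj.2]) (Finset.mem_union_left _ hiX₀)
      simp only [hg'0 i hiX, sub_zero, sub_smul, Finset.sum_sub_distrib] at h1
      have h2 : ‖∑ j, g j • B j - ∑ j, g' j • B j‖ ≤ η + η := by
        have : ∑ j, g j • B j - ∑ j, g' j • B j
            = (v - ∑ j, g' j • B j) - (v - ∑ j, g j • B j) := by abel
        rw [this]
        exact (norm_sub_le _ _).trans (add_le_add hg'n hgn)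
      calc |g i| ≤ K * (η + η) := h1.trans (by gcongr)
        _ = _ := by ring
    · rw [hg0 i hiX₀, abs_zero]
      positivity
  refine ⟨fun i => if i ∈ I then g i else 0, fun i hi => by simp [hi], ?_⟩
  have h3 : v - ∑ i, (if i ∈ I then g i else 0) • B i
      = (v - ∑ i, g i • B i) + ∑ i, (if i ∈ I then 0 else g i) • B i := by
    rw [sub_add, ← Finset.sum_sub_distrib]
    congr 1
    refine Finset.sum_congr rfl fun i _ => ?_
    split_ifs <;> simp
  rw [h3]
  have h4 : ‖∑ i, (if i ∈ I then 0 else g i) • B i‖ ≤ Fintype.card ι * (2 * K * η * K) := by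
    refine norm_sum_smul_le_card_mul hKpos.le (fun i => ?_) fun i _ => hB i
    split_ifs with hi
    · rw [abs_zero]; positivity
    · exact hsmall i hi
  have h5 : (Fintype.card ι : ℝ) * (2 * K * η * K) ≤ K * (2 * K * η * K) := by gcongr
  have h6 : η ≤ K ^ 3 * η := le_mul_of_one_le_left hη0 (one_le_pow₀ hK)
  refine (norm_add_le _ _).trans ?_
  linarith

/-! ### Combinatorics: from set incidences to a permutation -/

/-- For m-sets S, `I p ⊆ φ S` holds exactly when p ∈ S. So the union of the `I s` over an initial
set grows strictly whenever an index is added, as long as at most m indices are used. Starting from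
p and filling up an m-set S, the bound |φ S| = m leaves |I p| ≤ 1. An empty `I p`, or two equal
ones, would violate `hnot`. -/
theorem exists_perm_of_finsets {R m : ℕ} (hm : 1 ≤ m) (hmR : m < R)
    (I : Fin R → Finset (Fin R)) (φ : Finset (Fin R) → Finset (Fin R))
    (hφ : ∀ S, S.card = m → (φ S).card = m)
    (hsub : ∀ S, S.card = m → ∀ s ∈ S, I s ⊆ φ S)
    (hnot : ∀ S, S.card = m → ∀ p ∉ S, ¬ I p ⊆ φ S) :
    ∃ π : Equiv.Perm (Fin R), ∀ p, I p = {π p} := by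
  have hext : ∀ (J : Finset (Fin R)) (q : Fin R), q ∉ J → J.card ≤ m →
      ∃ S, J ⊆ S ∧ q ∉ S ∧ S.card = m := by
    intro J q hq hJ
    obtain ⟨S, hJS, hS, hcard⟩ := Finset.exists_subsuperset_card_eq
      (s := J) (t := Finset.univ.erase q) (n := m)
      (fun i hi => Finset.mem_erase.2 ⟨fun h => hq (h ▸ hi), Finset.mem_univ _⟩) hJ
      (by rw [Finset.card_erase_of_mem (Finset.mem_univ _), Finset.card_univ, Fintype.card_fin]
          omega)
    exact ⟨S, hJS, fun h => (Finset.mem_erase.1 (hS h)).1 rfl, hcard⟩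
  have hgrow : ∀ (p : Fin R) (J : Finset (Fin R)), p ∉ J → J.card + 1 ≤ m →
      (I p).card + J.card ≤ ((insert p J).biUnion I).card := by
    intro p J
    induction J using Finset.induction with
    | empty => simp
    | insert q J hq ih =>
      intro hp hcard
      rw [Finset.card_insert_of_notMem hq] at hcard ⊢
      have hpJ : p ∉ J := fun h => hp (Finset.mem_insert_of_mem h)
      have hpq : q ∉ insert p J := by
        simp only [Finset.mem_insert, not_or]
        exact ⟨fun h => hp (h ▸ Finset.mem_insert_self _ _), hq⟩
      obtain ⟨S, hS, hqS, hSm⟩ := hext (insert p J) q hpq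
        (by rw [Finset.card_insert_of_notMem hpJ]; omega)
      have h1 := ih hpJ (by omega)
      have h2 : (insert p J).biUnion I ⊂ (insert p (insert q J)).biUnion I := by
        rw [Finset.ssubset_iff_of_subset]
        · obtain ⟨i, hi, hiS⟩ := Finset.not_subset.1 (hnot S hSm q hqS)
          refine ⟨i, Finset.mem_biUnion.2 ⟨q, by simp, hi⟩, fun hi' => hiS ?_⟩
          obtain ⟨s, hs, his⟩ := Finset.mem_biUnion.1 hi'
          exact hsub S hSm s (hS hs) his
        · exact Finset.biUnion_subset_biUnion_of_subset_left _
            (Finset.insert_subset_insert _ (Finset.subset_insert _ _))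
      have := Finset.card_lt_card h2
      omega
  have hone : ∀ p, ∃ i, I p = {i} := by
    intro p
    rw [← Finset.card_eq_one]
    obtain ⟨S, hpS, -, hS⟩ := Finset.exists_subsuperset_card_eq
      (s := {p}) (t := Finset.univ) (n := m) (Finset.subset_univ _) (by simpa using hm)
      (by simpa using hmR.le)
    have hp : p ∈ S := hpS (Finset.mem_singleton_self p)
    have h1 := hgrow p (S.erase p) (by simp) (by rw [Finset.card_erase_of_mem hp]; omega)
    rw [Finset.insert_erase hp, Finset.card_erase_of_mem hp] at h1
    have h2 : (S.biUnion I).card ≤ m := by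
      rw [← hφ S hS]
      exact Finset.card_le_card (Finset.biUnion_subset.2 (hsub S hS))
    have h3 : (I p).card ≠ 0 := by
      intro h0
      rw [Finset.card_eq_zero] at h0
      obtain ⟨S', -, hp', hS'⟩ := hext ∅ p (by simp) (by simp)
      exact hnot S' hS' p hp' (by rw [h0]; exact Finset.empty_subset _)
    omega
  choose f hf using hone
  have hinj : Function.Injective f := by
    intro p q hpq
    by_contra hne
    obtain ⟨S, hqS, hpS, hS⟩ := hext {q} p (by simpa using hne) (by simpa using hm)
    refine hnot S hS p hpS ?_
    rw [hf p, hpq, ← hf q]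
    exact hsub S hS q (hqS (Finset.mem_singleton_self q))
  exact ⟨Equiv.ofBijective f (Finite.injective_iff_bijective.1 hinj), hf⟩

/-! ### Three factors: matching the components -/

namespace KruskalClose

variable {R : ℕ} {E F G : Type*}
    [NormedAddCommGroup E] [InnerProductSpace ℝ E] [NormedAddCommGroup F] [InnerProductSpace ℝ F]
    [NormedAddCommGroup G] [InnerProductSpace ℝ G] {K ε : ℝ} {a b c : ℕ}
    {A A' : Fin R → E} {B B' : Fin R → F} {C C' : Fin R → G}

/-- Contracting with the projected vector `w r` and a z dual to `C r` over X leaves a multiple of `B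
r` plus small terms on the first side, and a combination of the `B' s`, s ∈ S, on the second. -/
theorem nearSpan_of_survives (h : KruskalClose K ε a b c A A' B B' C C') {S X : Finset (Fin R)}
    {w : Fin R → E} (hX : X.card + a = R + 1) (hw : h.Survives S X w) {r : Fin R} (hr : r ∈ X) :
    NearSpan B' S (2 * (ε * K ^ 9)) (B r) := by
  have hs := h.sum_ge
  have ha := h.a_le
  have hb := h.b_le
  have hc := h.c_le
  have hK := h.K_pos
  have hε := h.eps_nonneg
  obtain ⟨hw1, hw2, hw3, hw4⟩ := hw
  obtain ⟨z, hzn, hz1, hz0⟩ := h.sepC r (X.erase r) (by simp)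
    (by rw [Finset.card_erase_of_mem hr]; omega)
  have hwr : 0 < ‖w r‖ := by
    by_contra hcon
    have h0 : ‖w r‖ = 0 := le_antisymm (not_lt.1 hcon) (norm_nonneg _)
    have := hw3 r hr
    rw [h0, mul_zero] at this
    linarith
  refine ⟨fun s => ⟪w r, A' s⟫ * ⟪z, C' s⟫ / ‖w r‖ ^ 2, fun s hs => by simp [hw1 r s hs], ?_⟩
  -- The residual v serves as its own test vector: the difference of the two main terms is ‖w
  -- r‖²‖v‖².
  set v : F := B r - ∑ s, (⟪w r, A' s⟫ * ⟪z, C' s⟫ / ‖w r‖ ^ 2) • B' s with hv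
  have h1 := h.close (w r) v z
  have hsplit := (Finset.add_sum_erase Finset.univ
    (fun i => ⟪w r, A i⟫ * ⟪v, B i⟫ * ⟪z, C i⟫) (Finset.mem_univ r))
  have hself : ⟪w r, A r⟫ = ‖w r‖ ^ 2 := by
    rw [hw2 r _ (hw1 r), real_inner_self_eq_norm_sq]
  have hrest : |∑ i ∈ Finset.univ.erase r, ⟪w r, A i⟫ * ⟪v, B i⟫ * ⟪z, C i⟫|
      ≤ K * (‖w r‖ * (ε * K ^ 3) * (‖v‖ * K) * (K * K)) := by
    refine (Finset.abs_sum_le_sum_abs _ _).trans ?_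
    refine (Finset.sum_le_card_nsmul _ _
      (‖w r‖ * (ε * K ^ 3) * (‖v‖ * K) * (K * K)) fun i hi => ?_).trans ?_
    · by_cases hiX : i ∈ X
      · rw [hz0 i (Finset.mem_erase.2 ⟨(Finset.mem_erase.1 hi).1, hiX⟩), mul_zero, abs_zero]
        positivity
      · rw [abs_mul, abs_mul, hw2 i _ (hw1 r)]
        have e1 : |⟪w r, w i⟫| ≤ ‖w r‖ * (ε * K ^ 3) :=
          (abs_real_inner_le_norm _ _).trans (by gcongr; exact hw4 i hiX)
        have e2 : |⟪v, B i⟫| ≤ ‖v‖ * K :=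
          (abs_real_inner_le_norm _ _).trans (by gcongr; exact h.normB i)
        have e3 : |⟪z, C i⟫| ≤ K * K :=
          (abs_real_inner_le_norm _ _).trans (by gcongr; exact h.normC i)
        gcongr
    · rw [nsmul_eq_mul]
      refine mul_le_mul_of_nonneg_right ?_ (by positivity)
      refine le_trans ?_ h.R_le
      have := Finset.card_erase_le (s := (Finset.univ : Finset (Fin R))) (a := r)
      rw [Finset.card_univ, Fintype.card_fin] at this
      exact_mod_cast this
  have hvv : ‖w r‖ ^ 2 * ‖v‖ ^ 2
      = ‖w r‖ ^ 2 * ⟪v, B r⟫ - ∑ s, ⟪w r, A' s⟫ * ⟪v, B' s⟫ * ⟪z, C' s⟫ := by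
    rw [← real_inner_self_eq_norm_sq v]
    nth_rewrite 2 [hv]
    rw [inner_sub_right, mul_sub, inner_sum, Finset.mul_sum]
    congr 1
    refine Finset.sum_congr rfl fun s _ => ?_
    rw [inner_smul_right]
    field_simp
  have h2 : ‖w r‖ ^ 2 * ‖v‖ ^ 2 ≤ ε * (‖w r‖ * ‖v‖ * K)
      + K * (‖w r‖ * (ε * K ^ 3) * (‖v‖ * K) * (K * K)) := by
    have e1 : ε * (‖w r‖ * ‖v‖ * ‖z‖) ≤ ε * (‖w r‖ * ‖v‖ * K) := by gcongr
    rw [← hsplit, hself, hz1, mul_one] at h1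
    have e2 := (abs_le.1 h1).2
    have e3 := (abs_le.1 hrest).1
    linarith
  have h3 : ‖w r‖ * ‖v‖ ≤ 2 * (ε * K ^ 7) := by
    rcases (norm_nonneg v).eq_or_lt with h0 | h0
    · rw [← h0, mul_zero]; positivity
    · have e1 : (‖w r‖ * ‖v‖) * (‖w r‖ * ‖v‖) ≤ (ε * K + ε * K ^ 7) * (‖w r‖ * ‖v‖) := by
        linarith
      have e2 := le_of_mul_le_mul_right e1 (by positivity)
      have e3 : ε * K ≤ ε * K ^ 7 := by
        gcongr
        exact le_self_pow₀ h.one_le (by norm_num)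
      linarith
  calc ‖v‖ ≤ (K ^ 2 * ‖w r‖) * ‖v‖ := le_mul_of_one_le_left (norm_nonneg _) (hw3 r hr)
    _ = K ^ 2 * (‖w r‖ * ‖v‖) := by ring
    _ ≤ K ^ 2 * (2 * (ε * K ^ 7)) := by gcongr
    _ = _ := by ring

theorem Survives.swap {h : KruskalClose K ε a b c A A' B B' C C'} {S X : Finset (Fin R)}
    {w : Fin R → E} (hw : h.Survives S X w) : h.swap.Survives S X w := hw

theorem nearSpan_reverse (h : KruskalClose K ε a b c A A' B B' C C') {S X : Finset (Fin R)}
    {w : Fin R → E} (hS : S.card + a = R + 1) (hX : X.card + a = R + 1) (hw : h.Survives S X w)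
    {s : Fin R} (hsS : s ∈ S) :
    NearSpan B X (4 * (ε * K ^ 12)) (B' s) := by
  have hs := h.sum_ge
  have ha := h.a_le
  have hc := h.c_le
  have hε := h.eps_nonneg
  have hK := h.K_pos
  have h11 := h.eps_mul_pow_le (m := 11) (by norm_num)
  refine (NearSpan.reverse (B := B) (B' := B') (X := X) (S := S) (η := 2 * (ε * K ^ 9))
    h.one_le (by simpa using h.R_le) h.sepB h.normB' (by omega) (by omega) ?_ (by positivity)
    (fun r hr => h.nearSpan_of_survives hX hw hr) hsS).mono subset_rfl (le_of_eq (by ring))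
  have : 2 * K ^ 2 * (2 * (ε * K ^ 9)) = 4 * (ε * K ^ 11) := by ring
  have h0 : 0 ≤ ε * K ^ 11 := by positivity
  linarith

/-- The a - 1 vectors `A i`, i ∉ X, have a combination x orthogonal to the a - 2 vectors `A' s`, s ∉
S. If all `B' s`, s ∈ S, were near the span over X, then a y dual to `B r` and killing that span
would make the second tensor small at x, so x would be nearly orthogonal to every `A r`, r ∉ X. That
makes ‖x‖ small, against ‖x‖ ≥ 1/K. -/
theorem not_forall_nearSpan (h : KruskalClose K ε a b c A A' B B' C C') {S X : Finset (Fin R)}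
    (hS : S.card + a = R + 2) (hX : X.card + a = R + 1) :
    ¬ ∀ s ∈ S, NearSpan B X (12 * (ε * K ^ 15)) (B' s) := by
  intro hnear
  have hs := h.sum_ge
  have ha := h.a_le
  have hb := h.b_le
  have hc := h.c_le
  have hK := h.K_pos
  have hε := h.eps_nonneg
  have hXc : Xᶜ.card = R - X.card := by rw [Finset.card_compl, Fintype.card_fin]
  have hSc : Sᶜ.card = R - S.card := by rw [Finset.card_compl, Fintype.card_fin]
  obtain ⟨g, hg0, hg1, ⟨r₀, hr₀, hgr⟩, hgS⟩ := exists_normalized_relation Xᶜ Sᶜ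
    (by omega) (fun i s => ⟪A i, A' s⟫)
  set x : E := ∑ i, g i • A i with hx
  have hxS : ∀ s ∉ S, ⟪x, A' s⟫ = 0 := by
    intro s hs
    rw [hx, sum_inner, ← hgS s (Finset.mem_compl.2 hs)]
    simp only [real_inner_smul_left]
  have h1 : 1 ≤ K * ‖x‖ := by
    have := h.sepA.abs_coeff_le (by omega) hg0 hr₀
    rwa [hgr, abs_one] at this
  have hxpos : 0 < ‖x‖ := by
    by_contra hcon
    have : ‖x‖ = 0 := le_antisymm (not_lt.1 hcon) (norm_nonneg _)
    rw [this, mul_zero] at h1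
    linarith
  have hxA : ∀ r ∉ X, |⟪x, A r⟫| ≤ 13 * (ε * K ^ 20) * ‖x‖ := by
    intro r hr
    obtain ⟨Z₁, Z₂, hZ, hZ₁, hZ₂⟩ := (insert r X)ᶜ.exists_union_card_le
      (b := b - 1 - X.card) (c := c - 1)
      (by rw [Finset.card_compl, Fintype.card_fin, Finset.card_insert_of_notMem hr]; omega)
    have hrZ : r ∉ Z₁ ∪ Z₂ := by rw [← hZ]; simp
    rw [Finset.mem_union, not_or] at hrZ
    obtain ⟨y, hyn, hy1, hy0⟩ := h.sepB r (X ∪ Z₁) (by simp [hr, hrZ.1])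
      (lt_of_le_of_lt (Finset.card_union_le _ _) (by omega))
    obtain ⟨z, hzn, hz1, hz0⟩ := h.sepC r Z₂ hrZ.2 (by omega)
    have e1 := h.close x y z
    have e2 : ∑ i, ⟪x, A i⟫ * ⟪y, B i⟫ * ⟪z, C i⟫ = ⟪x, A r⟫ := by
      rw [Finset.sum_eq_single r]
      · rw [hy1, hz1, mul_one, mul_one]
      · intro i _ hir
        by_cases hiX : i ∈ X
        · rw [hy0 i (Finset.mem_union_left _ hiX), mul_zero, zero_mul]
        · have : i ∈ Z₁ ∪ Z₂ := by rw [← hZ]; simp [hir, hiX]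
          rcases Finset.mem_union.1 this with hi | hi
          · rw [hy0 i (Finset.mem_union_right _ hi), mul_zero, zero_mul]
          · rw [hz0 i hi, mul_zero]
      · simp
    have e3 : |∑ s, ⟪x, A' s⟫ * ⟪y, B' s⟫ * ⟪z, C' s⟫|
        ≤ K * (‖x‖ * K * (K * (12 * (ε * K ^ 15))) * (K * K)) := by
      refine (Finset.abs_sum_le_sum_abs _ _).trans ?_
      refine (Finset.sum_le_card_nsmul _ _
        (‖x‖ * K * (K * (12 * (ε * K ^ 15))) * (K * K)) fun s _ => ?_).trans ?_
      · by_cases hsS : s ∈ S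
        · rw [abs_mul, abs_mul]
          have f1 : |⟪x, A' s⟫| ≤ ‖x‖ * K :=
            (abs_real_inner_le_norm _ _).trans (by gcongr; exact h.normA' s)
          have f2 : |⟪y, B' s⟫| ≤ K * (12 * (ε * K ^ 15)) := by
            obtain ⟨d, hd0, hdn⟩ := hnear s hsS
            have : ⟪y, B' s⟫ = ⟪y, B' s - ∑ i, d i • B i⟫ := by
              rw [inner_sub_right, inner_sum, Finset.sum_eq_zero, sub_zero]
              intro i _
              rw [inner_smul_right]
              by_cases hiX : i ∈ X
              · rw [hy0 i (Finset.mem_union_left _ hiX), mul_zero]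
              · rw [hd0 i hiX, zero_mul]
            rw [this]
            exact (abs_real_inner_le_norm _ _).trans (by gcongr)
          have f3 : |⟪z, C' s⟫| ≤ K * K :=
            (abs_real_inner_le_norm _ _).trans (by gcongr; exact h.normC' s)
          gcongr
        · rw [hxS s hsS, zero_mul, zero_mul, abs_zero]
          positivity
      · rw [nsmul_eq_mul, Finset.card_univ, Fintype.card_fin]
        exact mul_le_mul_of_nonneg_right h.R_le (by positivity)
    rw [e2] at e1
    have e4 : |⟪x, A r⟫| ≤ ε * (‖x‖ * ‖y‖ * ‖z‖)
        + K * (‖x‖ * K * (K * (12 * (ε * K ^ 15))) * (K * K)) := by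
      have := abs_sub_abs_le_abs_sub ⟪x, A r⟫ (∑ s, ⟪x, A' s⟫ * ⟪y, B' s⟫ * ⟪z, C' s⟫)
      linarith
    have e5 : ε * (‖x‖ * ‖y‖ * ‖z‖) ≤ ε * (‖x‖ * K * K) := by gcongr
    have e6 : ε * K ^ 2 * ‖x‖ ≤ ε * K ^ 20 * ‖x‖ := by
      gcongr
      · exact h.one_le
      · norm_num
    calc |⟪x, A r⟫| ≤ ε * (‖x‖ * K * K)
          + K * (‖x‖ * K * (K * (12 * (ε * K ^ 15))) * (K * K)) := by linarith
      _ = ε * K ^ 2 * ‖x‖ + 12 * (ε * K ^ 20 * ‖x‖) := by ring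
      _ ≤ ε * K ^ 20 * ‖x‖ + 12 * (ε * K ^ 20 * ‖x‖) := by gcongr
      _ = _ := by ring
  have h2 : ‖x‖ * ‖x‖ ≤ K * (13 * (ε * K ^ 20)) * ‖x‖ := by
    rw [← sq, ← real_inner_self_eq_norm_sq]
    nth_rewrite 2 [hx]
    rw [inner_sum]
    refine (Finset.sum_le_card_nsmul _ _ (13 * (ε * K ^ 20) * ‖x‖) fun i _ => ?_).trans ?_
    · rw [inner_smul_right]
      by_cases hiX : i ∈ X
      · rw [hg0 i (by simpa using hiX), zero_mul]; positivity
      · calc g i * ⟪x, A i⟫ ≤ |g i * ⟪x, A i⟫| := le_abs_self _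
          _ = |g i| * |⟪x, A i⟫| := abs_mul _ _
          _ ≤ 1 * (13 * (ε * K ^ 20) * ‖x‖) :=
            mul_le_mul (hg1 i) (hxA i hiX) (abs_nonneg _) zero_le_one
          _ = _ := one_mul _
    · rw [nsmul_eq_mul, Finset.card_univ, Fintype.card_fin, mul_assoc K]
      exact mul_le_mul_of_nonneg_right h.R_le (by positivity)
  have h3 := le_of_mul_le_mul_right h2 hxpos
  have h4 : K * ‖x‖ ≤ K * (K * (13 * (ε * K ^ 20))) := by gcongr
  have h5 := h.eps_mul_pow_le (m := 22) le_rfl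
  have h6 : K * (K * (13 * (ε * K ^ 20))) = 13 * (ε * K ^ 22) := by ring
  have h7 : 0 ≤ ε * K ^ 22 := by positivity
  linarith

theorem exists_perm_nearSpan (h : KruskalClose K ε a b c A A' B B' C C') :
    ∃ π : Equiv.Perm (Fin R), ∀ p, NearSpan B {π p} (12 * (ε * K ^ 15)) (B' p) ∧
      NearSpan C {π p} (12 * (ε * K ^ 15)) (C' p) := by
  classical
  have hs := h.sum_ge
  have ha := h.a_le
  have hb := h.b_le
  have hc := h.c_le
  have hK := h.K_pos
  have hε := h.eps_nonneg
  have hex : ∀ S : Finset (Fin R), S.card = R + 1 - a → ∃ X : Finset (Fin R),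
      X.card = R + 1 - a ∧ (∀ s ∈ S, NearSpan B X (4 * (ε * K ^ 12)) (B' s)) ∧
      ∀ s ∈ S, NearSpan C X (4 * (ε * K ^ 12)) (C' s) := by
    intro S hS
    obtain ⟨X, w, hX, hw⟩ := h.exists_survives (S := S) (by omega)
    exact ⟨X, by omega, fun s hsS => h.nearSpan_reverse (by omega) hX hw hsS,
      fun s hsS => h.swap.nearSpan_reverse (by omega) hX hw.swap hsS⟩
  choose! φ hφ hφB hφC using hex
  -- The sets φ S have size m = R + 1 - a, and 2m ≤ min(b, c) because a is the largest rank. This is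
  -- what allows spans to be intersected.
  let I : Fin R → Finset (Fin R) := fun p =>
    Finset.univ.filter fun i => ∀ S : Finset (Fin R), S.card = R + 1 - a → p ∈ S → i ∈ φ S
  let 𝒳 : Fin R → Set (Finset (Fin R)) := fun p =>
    {X | ∃ S : Finset (Fin R), S.card = R + 1 - a ∧ p ∈ S ∧ X = φ S}
  have h𝒳 : ∀ p, (𝒳 p).Nonempty := by
    intro p
    obtain ⟨S, hpS, -, hS⟩ := Finset.exists_subsuperset_card_eq
      (s := {p}) (t := Finset.univ) (n := R + 1 - a) (Finset.subset_univ _)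
      (by rw [Finset.card_singleton]; omega)
      (by rw [Finset.card_univ, Fintype.card_fin]; omega)
    exact ⟨φ S, S, hS, hpS (Finset.mem_singleton_self p), rfl⟩
  have hI : ∀ p, ∀ i ∉ I p, ∃ X ∈ 𝒳 p, i ∉ X := by
    intro p i hi
    simp only [I, Finset.mem_filter, Finset.mem_univ, true_and, not_forall] at hi
    obtain ⟨S, hS, hpS, hiS⟩ := hi
    exact ⟨φ S, ⟨S, hS, hpS, rfl⟩, hiS⟩
  have hIB : ∀ p, NearSpan B (I p) (12 * (ε * K ^ 15)) (B' p) := by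
    intro p
    refine (NearSpan.inter (η := 4 * (ε * K ^ 12)) h.one_le (by simpa using h.R_le) h.sepB h.normB
      (by positivity) ?_ (h𝒳 p) ?_ (hI p)).mono subset_rfl (le_of_eq (by ring))
    · rintro X ⟨S, hS, -, rfl⟩
      rw [hφ S hS]; omega
    · rintro X ⟨S, hS, hp, rfl⟩
      exact hφB S hS p hp
  have hIC : ∀ p, NearSpan C (I p) (12 * (ε * K ^ 15)) (C' p) := by
    intro p
    refine (NearSpan.inter (η := 4 * (ε * K ^ 12)) h.one_le (by simpa using h.R_le) h.sepC h.normC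
      (by positivity) ?_ (h𝒳 p) ?_ (hI p)).mono subset_rfl (le_of_eq (by ring))
    · rintro X ⟨S, hS, -, rfl⟩
      rw [hφ S hS]; omega
    · rintro X ⟨S, hS, hp, rfl⟩
      exact hφC S hS p hp
  have hmono : 4 * (ε * K ^ 12) ≤ 12 * (ε * K ^ 15) := by
    have : ε * K ^ 12 ≤ ε * K ^ 15 := by
      gcongr
      · exact h.one_le
      · norm_num
    have h0 : 0 ≤ ε * K ^ 12 := by positivity
    linarith
  obtain ⟨π, hπ⟩ := exists_perm_of_finsets (m := R + 1 - a) (by omega) (by omega) I φ hφ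
    (fun S hS s hs i hi => (Finset.mem_filter.1 hi).2 S hS hs)
    (by
      intro S hS p hp hsub
      refine h.not_forall_nearSpan (S := insert p S) (X := φ S)
        (by rw [Finset.card_insert_of_notMem hp]; omega) (by rw [hφ S hS]; omega) ?_
      intro s hs
      rcases Finset.mem_insert.1 hs with rfl | hs
      · exact (hIB _).mono hsub le_rfl
      · exact (hφB S hS s hs).mono subset_rfl hmono)
  exact ⟨π, fun p => hπ p ▸ ⟨hIB p, hIC p⟩⟩

end KruskalClose

/-! ### Three factors: closeness of matched terms -/

theorem NearSpan.exists_smul {ι F : Type*} [Fintype ι] [NormedAddCommGroup F]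
    [InnerProductSpace ℝ F] {B : ι → F} {i : ι} {η : ℝ} {v : F} (h : NearSpan B {i} η v) :
    ∃ t : ℝ, ‖v - t • B i‖ ≤ η := by
  obtain ⟨g, hg, hv⟩ := h
  refine ⟨g i, ?_⟩
  rwa [Finset.sum_eq_single i (fun j _ hj => by rw [hg j (by simpa using hj), zero_smul])
    (by simp)] at hv

namespace KruskalClose

variable {R : ℕ} {E F G : Type*}
    [NormedAddCommGroup E] [InnerProductSpace ℝ E] [NormedAddCommGroup F] [InnerProductSpace ℝ F]
    [NormedAddCommGroup G] [InnerProductSpace ℝ G] {K ε : ℝ} {a b c : ℕ}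
    {A A' : Fin R → E} {B B' : Fin R → F} {C C' : Fin R → G}

/-- Replacing `B' p`, `C' p` by the multiples β, γ of their partners and testing with dual vectors
gives `A (π p)` ≈ βγ `A' p`. The scalars are moved across the tensor product, so no lower bound on
βγ is needed. The constant is 84 = 12(3 + 4). -/
theorem exists_perm_term_close (h : KruskalClose K ε a b c A A' B B' C C') :
    ∃ π : Equiv.Perm (Fin R), ∀ p x y z,
      |⟪x, A' p⟫ * ⟪y, B' p⟫ * ⟪z, C' p⟫ - ⟪x, A (π p)⟫ * ⟪y, B (π p)⟫ * ⟪z, C (π p)⟫|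
        ≤ 84 * (ε * K ^ 22) * (‖x‖ * ‖y‖ * ‖z‖) := by
  have hs := h.sum_ge
  have ha := h.a_le
  have hb := h.b_le
  have hc := h.c_le
  have hK := h.K_pos
  have hε := h.eps_nonneg
  obtain ⟨π, hπ⟩ := h.exists_perm_nearSpan
  choose β hβ using fun p => (hπ p).1.exists_smul
  choose γ hγ using fun p => (hπ p).2.exists_smul
  set η : ℝ := 12 * (ε * K ^ 15) with hη
  have hη0 : 0 ≤ η := by positivity
  have hηK : η ≤ K := by
    have h1 := h.eps_mul_pow_le (m := 15) (by norm_num)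
    have h2 := h.one_le
    have h3 : 0 ≤ ε * K ^ 15 := by positivity
    linarith
  have hεη : ε ≤ η := by
    have : ε ≤ ε * K ^ 15 := le_mul_of_one_le_right hε (one_le_pow₀ h.one_le)
    linarith
  have hfirst : ∀ p x y z, |⟪x, A' p⟫ * ⟪y, B' p⟫ * ⟪z, C' p⟫
      - ⟪x, A' p⟫ * ⟪y, β p • B (π p)⟫ * ⟪z, γ p • C (π p)⟫|
      ≤ 3 * K ^ 2 * η * (‖x‖ * ‖y‖ * ‖z‖) := by
    intro p x y z
    have e1 : ⟪x, A' p⟫ * ⟪y, B' p⟫ * ⟪z, C' p⟫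
        - ⟪x, A' p⟫ * ⟪y, β p • B (π p)⟫ * ⟪z, γ p • C (π p)⟫
        = ⟪x, A' p⟫ * (⟪y, B' p - β p • B (π p)⟫ * ⟪z, C' p⟫
          + ⟪y, β p • B (π p)⟫ * ⟪z, C' p - γ p • C (π p)⟫) := by
      rw [inner_sub_right, inner_sub_right]; ring
    have hbn : ‖β p • B (π p)‖ ≤ 2 * K := by
      have : β p • B (π p) = B' p - (B' p - β p • B (π p)) := by abel
      rw [this]
      have := norm_sub_le (B' p) (B' p - β p • B (π p))
      have := hβ p
      have := h.normB' p
      linarith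
    have f1 : |⟪x, A' p⟫| ≤ ‖x‖ * K :=
      (abs_real_inner_le_norm _ _).trans (by gcongr; exact h.normA' p)
    have f2 : |⟪y, B' p - β p • B (π p)⟫| ≤ ‖y‖ * η :=
      (abs_real_inner_le_norm _ _).trans (by gcongr; exact hβ p)
    have f3 : |⟪z, C' p⟫| ≤ ‖z‖ * K :=
      (abs_real_inner_le_norm _ _).trans (by gcongr; exact h.normC' p)
    have f4 : |⟪y, β p • B (π p)⟫| ≤ ‖y‖ * (2 * K) :=
      (abs_real_inner_le_norm _ _).trans (by gcongr)
    have f5 : |⟪z, C' p - γ p • C (π p)⟫| ≤ ‖z‖ * η :=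
      (abs_real_inner_le_norm _ _).trans (by gcongr; exact hγ p)
    rw [e1, abs_mul]
    have f6 : |⟪y, B' p - β p • B (π p)⟫ * ⟪z, C' p⟫
          + ⟪y, β p • B (π p)⟫ * ⟪z, C' p - γ p • C (π p)⟫|
        ≤ ‖y‖ * η * (‖z‖ * K) + ‖y‖ * (2 * K) * (‖z‖ * η) := by
      refine (abs_add_le _ _).trans ?_
      rw [abs_mul, abs_mul]
      gcongr
    calc _ ≤ ‖x‖ * K * (‖y‖ * η * (‖z‖ * K) + ‖y‖ * (2 * K) * (‖z‖ * η)) := by gcongr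
      _ = _ := by ring
  have hA : ∀ p x, |⟪x, A (π p)⟫ - β p * γ p * ⟪x, A' p⟫| ≤ 4 * K ^ 5 * η * ‖x‖ := by
    intro p x
    obtain ⟨Z₁, Z₂, hZ, hZ₁, hZ₂⟩ := (Finset.univ.erase (π p)).exists_union_card_le
      (b := b - 1) (c := c - 1)
      (by rw [Finset.card_erase_of_mem (Finset.mem_univ _), Finset.card_univ, Fintype.card_fin]
          omega)
    have hrZ : π p ∉ Z₁ ∪ Z₂ := by rw [← hZ]; simp
    rw [Finset.mem_union, not_or] at hrZ
    obtain ⟨y, hyn, hy1, hy0⟩ := h.sepB (π p) Z₁ hrZ.1 (by omega)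
    obtain ⟨z, hzn, hz1, hz0⟩ := h.sepC (π p) Z₂ hrZ.2 (by omega)
    have hyz : ∀ i, i ≠ π p → ⟪y, B i⟫ * ⟪z, C i⟫ = 0 := by
      intro i hi
      have : i ∈ Z₁ ∪ Z₂ := by rw [← hZ]; simp [hi]
      rcases Finset.mem_union.1 this with hi | hi
      · rw [hy0 i hi, zero_mul]
      · rw [hz0 i hi, mul_zero]
    have e1 := h.close x y z
    have e2 : ∑ i, ⟪x, A i⟫ * ⟪y, B i⟫ * ⟪z, C i⟫ = ⟪x, A (π p)⟫ := by
      rw [Finset.sum_eq_single (π p)]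
      · rw [hy1, hz1, mul_one, mul_one]
      · intro i _ hi
        rw [mul_assoc, hyz i hi, mul_zero]
      · simp
    have e3 : ∑ i, ⟪x, A' i⟫ * ⟪y, β i • B (π i)⟫ * ⟪z, γ i • C (π i)⟫
        = β p * γ p * ⟪x, A' p⟫ := by
      rw [Finset.sum_eq_single p]
      · rw [inner_smul_right, inner_smul_right, hy1, hz1]; ring
      · intro i _ hi
        rw [inner_smul_right, inner_smul_right]
        have := hyz (π i) (fun hc => hi (π.injective hc))
        linear_combination ⟪x, A' i⟫ * β i * γ i * this
      · simp
    have e4 : |∑ i, ⟪x, A' i⟫ * ⟪y, B' i⟫ * ⟪z, C' i⟫ - β p * γ p * ⟪x, A' p⟫|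
        ≤ K * (3 * K ^ 2 * η * (‖x‖ * ‖y‖ * ‖z‖)) := by
      rw [← e3, ← Finset.sum_sub_distrib]
      refine (Finset.abs_sum_le_sum_abs _ _).trans ?_
      refine (Finset.sum_le_card_nsmul _ _ _ fun i _ => hfirst i x y z).trans ?_
      rw [nsmul_eq_mul, Finset.card_univ, Fintype.card_fin]
      exact mul_le_mul_of_nonneg_right h.R_le (by positivity)
    rw [e2] at e1
    have e5 := (abs_sub_le ⟪x, A (π p)⟫ _ _).trans (add_le_add e1 e4)
    refine e5.trans ?_
    have hxyz : ‖x‖ * ‖y‖ * ‖z‖ ≤ ‖x‖ * K * K := by gcongr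
    have hεη' : ε ≤ K ^ 3 * η := hεη.trans (le_mul_of_one_le_left hη0 (one_le_pow₀ h.one_le))
    calc ε * (‖x‖ * ‖y‖ * ‖z‖) + K * (3 * K ^ 2 * η * (‖x‖ * ‖y‖ * ‖z‖))
        ≤ K ^ 3 * η * (‖x‖ * K * K) + K * (3 * K ^ 2 * η * (‖x‖ * K * K)) := by gcongr
      _ = _ := by ring
  refine ⟨π, fun p x y z => ?_⟩
  have e1 : |⟪x, A' p⟫ * ⟪y, β p • B (π p)⟫ * ⟪z, γ p • C (π p)⟫
      - ⟪x, A (π p)⟫ * ⟪y, B (π p)⟫ * ⟪z, C (π p)⟫|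
      ≤ 4 * K ^ 5 * η * ‖x‖ * (‖y‖ * K) * (‖z‖ * K) := by
    have : ⟪x, A' p⟫ * ⟪y, β p • B (π p)⟫ * ⟪z, γ p • C (π p)⟫
      - ⟪x, A (π p)⟫ * ⟪y, B (π p)⟫ * ⟪z, C (π p)⟫
      = -((⟪x, A (π p)⟫ - β p * γ p * ⟪x, A' p⟫) * ⟪y, B (π p)⟫ * ⟪z, C (π p)⟫) := by
      rw [inner_smul_right, inner_smul_right]; ring
    rw [this, abs_neg, abs_mul, abs_mul]
    have f1 := hA p x
    have f2 : |⟪y, B (π p)⟫| ≤ ‖y‖ * K :=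
      (abs_real_inner_le_norm _ _).trans (by gcongr; exact h.normB _)
    have f3 : |⟪z, C (π p)⟫| ≤ ‖z‖ * K :=
      (abs_real_inner_le_norm _ _).trans (by gcongr; exact h.normC _)
    gcongr
  refine (abs_sub_le _ _ _).trans ((add_le_add (hfirst p x y z) e1).trans ?_)
  have hpow : K ^ 2 ≤ K ^ 7 := pow_le_pow_right₀ h.one_le (by norm_num)
  calc 3 * K ^ 2 * η * (‖x‖ * ‖y‖ * ‖z‖) + 4 * K ^ 5 * η * ‖x‖ * (‖y‖ * K) * (‖z‖ * K)
      ≤ 3 * K ^ 7 * η * (‖x‖ * ‖y‖ * ‖z‖) + 4 * K ^ 5 * η * ‖x‖ * (‖y‖ * K) * (‖z‖ * K) := by gcongr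
    _ = _ := by rw [hη]; ring

end KruskalClose

/-! ### From robust Kruskal rank to dual vectors -/

theorem LinearMap.mul_norm_le_of_le_singularValues {E F : Type*}
    [NormedAddCommGroup E] [InnerProductSpace ℝ E] [FiniteDimensional ℝ E]
    [NormedAddCommGroup F] [InnerProductSpace ℝ F] [FiniteDimensional ℝ F]
    (T : E →ₗ[ℝ] F) {s : ℝ} (hs : 0 ≤ s)
    (h : s ≤ T.singularValues (Module.finrank ℝ E - 1)) (x : E) : s * ‖x‖ ≤ ‖T x‖ := by
  have hT := T.isSymmetric_adjoint_comp_self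
  let v := hT.eigenvectorBasis rfl
  have h1 : ‖T x‖ ^ 2 = ∑ i, hT.eigenvalues rfl i * (v.repr x i) ^ 2 := by
    rw [← real_inner_self_eq_norm_sq, ← LinearMap.adjoint_inner_left,
      ← LinearMap.comp_apply, ← v.repr.inner_map_map, PiLp.inner_apply]
    refine Finset.sum_congr rfl fun i _ => ?_
    rw [hT.eigenvectorBasis_apply_self_apply rfl x i]
    simp [v]
    ring
  have h2 : ‖x‖ ^ 2 = ∑ i, (v.repr x i) ^ 2 := by
    rw [← v.repr.norm_map, EuclideanSpace.norm_sq_eq]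
    simp
  have h3 : (s * ‖x‖) ^ 2 ≤ ‖T x‖ ^ 2 := by
    rw [mul_pow, h1, h2, Finset.mul_sum]
    refine Finset.sum_le_sum fun i _ => mul_le_mul_of_nonneg_right ?_ (sq_nonneg _)
    rw [← T.sq_singularValues_fin rfl i]
    have : T.singularValues (Module.finrank ℝ E - 1) ≤ T.singularValues i :=
      T.singularValues_antitone (by omega)
    exact pow_le_pow_left₀ hs (h.trans this) 2
  exact le_of_sq_le_sq h3 (norm_nonneg _)

theorem le_card_of_robustKruskalRank {n R k : ℕ} {τ : ℝ} {A : Matrix (Fin n) (Fin R) ℝ}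
    (h : robustKruskalRank τ A = k) (hk : 1 ≤ k) :
    k ≤ R ∧ ∀ S : Finset (Fin R), S.card = k → 1 / τ ≤ sigmaMat k (colSubmatrix A S) := by
  have hmem : k ∈ {k : ℕ | k ≤ Fintype.card (Fin R) ∧
      ∀ S : Finset (Fin R), S.card = k → 1 / τ ≤ sigmaMat k (colSubmatrix A S)} := by
    rw [← h]
    refine Nat.sSup_mem ?_ ⟨Fintype.card (Fin R), fun m hm => hm.1⟩
    -- The supremum of the empty set is 0, which k ≥ 1 excludes.
    by_contra hne
    rw [Set.not_nonempty_iff_eq_empty] at hne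
    rw [robustKruskalRank, hne] at h
    simp at h
    omega
  simpa using hmem

/-- The dual vector is the component w of column r orthogonal to the columns in Z, divided by ‖w‖².
The singular value bound says ‖w‖ ≥ 1/τ, since w is a combination of columns in which column r has
coefficient 1. -/
theorem dualSep_of_robustKruskalRank {n R k : ℕ} {τ : ℝ} {A : Matrix (Fin n) (Fin R) ℝ}
    (hτ : 0 < τ) (h : robustKruskalRank τ A = k) (hk : 1 ≤ k) :
    DualSep k τ (fun r => (WithLp.toLp 2 (A.col r) : EuclideanSpace ℝ (Fin n))) := by
  classical
  obtain ⟨hkR, hσ⟩ := le_card_of_robustKruskalRank h hk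
  intro r Z hr hZ
  obtain ⟨S, hS, -, hcard⟩ := Finset.exists_subsuperset_card_eq
    (s := insert r Z) (t := Finset.univ) (n := k) (Finset.subset_univ _)
    (by rw [Finset.card_insert_of_notMem hr]; omega) (by simpa using hkR)
  have hrS : r ∈ S := hS (Finset.mem_insert_self _ _)
  set u : Fin R → EuclideanSpace ℝ (Fin n) := fun r => WithLp.toLp 2 (A.col r) with hu
  have hlow : ∀ g : Fin R → ℝ, g r = 1 → (∀ i ∉ S, g i = 0) → 1 ≤ τ * ‖∑ i, g i • u i‖ := by
    intro g hgr hg0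
    let x : EuclideanSpace ℝ S := WithLp.toLp 2 fun i => g i
    have h1 := (Matrix.toEuclideanLin (colSubmatrix A S)).mul_norm_le_of_le_singularValues
      (s := 1 / τ) (by positivity) (by simpa [hcard, sigmaMat] using hσ S hcard) x
    have h2 : Matrix.toEuclideanLin (colSubmatrix A S) x = ∑ i, g i • u i := by
      rw [← Finset.sum_subset (Finset.subset_univ S)
        (fun i _ hi => by rw [hg0 i hi, zero_smul]), ← Finset.sum_coe_sort S]
      ext m
      simp [x, hu, Matrix.toLpLin_apply, Matrix.mulVec, dotProduct, colSubmatrix, mul_comm]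
    have h3 : 1 ≤ ‖x‖ := by
      have := PiLp.norm_apply_le x ⟨r, hrS⟩
      simpa [x, hgr] using this
    rw [h2] at h1
    calc (1 : ℝ) ≤ ‖x‖ := h3
      _ = τ * (1 / τ * ‖x‖) := by field_simp
      _ ≤ _ := by gcongr
  let W : Submodule ℝ (EuclideanSpace ℝ (Fin n)) := Submodule.span ℝ (u '' Z)
  set w := u r - W.starProjection (u r) with hw
  have hwperp : ∀ s ∈ Z, ⟪w, u s⟫ = 0 := fun s hs => by
    have hm : u s ∈ W := Submodule.subset_span ⟨s, hs, rfl⟩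
    exact Submodule.inner_left_of_mem_orthogonal hm (W.sub_starProjection_mem_orthogonal (u r))
  have hww : ⟪w, u r⟫ = ‖w‖ ^ 2 := by
    have h1 : u r = w + W.starProjection (u r) := by rw [hw]; abel
    nth_rewrite 1 [h1]
    rw [inner_add_right, real_inner_self_eq_norm_sq,
      Submodule.inner_left_of_mem_orthogonal (W.starProjection_apply_mem (u r))
        (W.sub_starProjection_mem_orthogonal (u r)), add_zero]
  have hwn : 1 ≤ τ * ‖w‖ := by
    obtain ⟨g, hg⟩ : ∃ g : Fin R → ℝ, (∀ i ∉ Z, g i = 0) ∧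
        ∑ i, g i • u i = W.starProjection (u r) := by
      obtain ⟨g, hgs⟩ :=
        (Submodule.mem_span_image_finset_iff_exists_fun ℝ).1 (W.starProjection_apply_mem (u r))
      refine ⟨fun i => if hi : i ∈ Z then g ⟨i, hi⟩ else 0, fun i hi => by simp [hi], ?_⟩
      rw [← hgs, ← Finset.sum_subset (Finset.subset_univ Z) (fun i _ hi => by simp [hi]),
        ← Finset.sum_coe_sort Z]
      simp
    have := hlow (fun i => (if i = r then 1 else 0) - g i) (by simp [hg.1 r hr])
      (fun i hi => by
        have : i ∉ insert r Z := fun h' => hi (hS h')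
        rw [Finset.mem_insert, not_or] at this
        simp [this.1, hg.1 i this.2])
    simpa [sub_smul, Finset.sum_sub_distrib, hg.2, ite_smul] using this
  have hwpos : 0 < ‖w‖ := by
    by_contra hcon
    have h0 : ‖w‖ = 0 := le_antisymm (not_lt.1 hcon) (norm_nonneg _)
    rw [h0, mul_zero] at hwn
    linarith
  refine ⟨(‖w‖ ^ 2)⁻¹ • w, ?_, ?_, fun s hs => ?_⟩
  · rw [norm_smul, norm_inv, norm_pow, norm_norm]
    have : (‖w‖ ^ 2)⁻¹ * ‖w‖ = ‖w‖⁻¹ := by field_simp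
    rw [this, inv_le_iff_one_le_mul₀ hwpos]
    exact hwn
  · rw [real_inner_smul_left, hww, inv_mul_cancel₀ (by positivity)]
  · rw [real_inner_smul_left, hwperp s hs, mul_zero]

/-! ### Elementary tensors and grouping of factors -/

/-- The elementary tensor `⨂ j, u j`, as an array. -/
noncomputable def elemTensor {J : Type*} [Fintype J] {n : J → ℕ}
    (u : ∀ j, EuclideanSpace ℝ (Fin (n j))) : EuclideanSpace ℝ (∀ j, Fin (n j)) :=
  WithLp.toLp 2 fun i => ∏ j, u j (i j)

theorem inner_elemTensor {J : Type*} [Fintype J] [DecidableEq J] {n : J → ℕ}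
    (y u : ∀ j, EuclideanSpace ℝ (Fin (n j))) :
    ⟪elemTensor y, elemTensor u⟫ = ∏ j, ⟪y j, u j⟫ := by
  simp only [PiLp.inner_apply, elemTensor]
  rw [Finset.prod_univ_sum]
  simp only [Fintype.piFinset_univ]
  refine Finset.sum_congr rfl fun i _ => ?_
  simp [Finset.prod_mul_distrib]

theorem norm_elemTensor {J : Type*} [Fintype J] [DecidableEq J] {n : J → ℕ}
    (u : ∀ j, EuclideanSpace ℝ (Fin (n j))) : ‖elemTensor u‖ = ∏ j, ‖u j‖ := by
  have h : ‖elemTensor u‖ ^ 2 = (∏ j, ‖u j‖) ^ 2 := by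
    rw [← real_inner_self_eq_norm_sq, inner_elemTensor, ← Finset.prod_pow]
    simp only [real_inner_self_eq_norm_sq]
  exact (sq_eq_sq₀ (norm_nonneg _) (Finset.prod_nonneg fun _ _ => norm_nonneg _)).1 h

theorem Finset.exists_fiber_card_le {ι J : Type*} [Fintype J] [DecidableEq ι] [DecidableEq J]
    (Z : Finset ι) (κ : J → ℕ) (h : Z.card ≤ ∑ j, κ j) :
    ∃ Y : J → Finset ι, (∀ j, Y j ⊆ Z) ∧ (∀ j, (Y j).card ≤ κ j) ∧ ∀ s ∈ Z, ∃ j, s ∈ Y j := by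
  have : Fintype.card Z ≤ Fintype.card (Σ j, Fin (κ j)) := by simpa using h
  obtain ⟨f⟩ := Function.Embedding.nonempty_of_card_le this
  refine ⟨fun j => (Finset.univ.filter fun s : Z => (f s).1 = j).map (Function.Embedding.subtype _),
    ?_, ?_, ?_⟩
  · intro j s hs
    simp only [Finset.mem_map, Function.Embedding.subtype_apply] at hs
    obtain ⟨s, -, rfl⟩ := hs
    exact s.2
  · intro j
    rw [Finset.card_map, ← Fintype.card_subtype, ← Fintype.card_fin (κ j)]
    refine Fintype.card_le_of_injective (fun s => s.2 ▸ (f s.1).2) ?_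
    rintro ⟨s, hs⟩ ⟨t, ht⟩ hst
    have : f s = f t := by
      refine Sigma.ext (hs.trans ht.symm) ?_
      subst hs
      simp only at hst
      rw [hst]
      simp
    exact Subtype.ext (f.injective this)
  · intro s hs
    exact ⟨(f ⟨s, hs⟩).1, by simp [hs]⟩

theorem DualSep.mono {ι E : Type*} [NormedAddCommGroup E] [InnerProductSpace ℝ E] {k m : ℕ}
    {τ K : ℝ} {A : ι → E} (h : DualSep k τ A) (hm : m ≤ k) (hK : τ ≤ K) : DualSep m K A := by
  intro r Z hr hZ
  obtain ⟨y, hy, hy'⟩ := h r Z hr (hZ.trans_le hm)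
  exact ⟨y, hy.trans hK, hy'⟩

/-- A product of dual vectors vanishes at s as soon as one factor does, so Z can be shared out, with
k_j - 1 indices for factor j. -/
theorem DualSep.elemTensor {ι J : Type*} [Fintype J] [DecidableEq J] {n : J → ℕ}
    {k : J → ℕ} {τ : J → ℝ} {u : ∀ j, ι → EuclideanSpace ℝ (Fin (n j))}
    (h : ∀ j, DualSep (k j) (τ j) (u j)) (hk : ∀ j, 1 ≤ k j) :
    DualSep (1 + ∑ j, (k j - 1)) (∏ j, τ j) (fun r => elemTensor fun j => u j r) := by
  classical
  intro r Z hr hZ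
  obtain ⟨Y, hYZ, hYc, hY⟩ := Z.exists_fiber_card_le (fun j => k j - 1) (by omega)
  choose y hyn hy1 hy0 using fun j => h j r (Y j) (fun hj => hr (hYZ j hj))
    (by have := hYc j; have := hk j; omega)
  refine ⟨_root_.elemTensor y, ?_, ?_, fun s hs => ?_⟩
  · rw [norm_elemTensor]
    exact Finset.prod_le_prod (fun _ _ => norm_nonneg _) fun j _ => hyn j
  · rw [inner_elemTensor]
    exact Finset.prod_eq_one fun j _ => hy1 j
  · rw [inner_elemTensor]
    obtain ⟨j, hj⟩ := hY s hs
    exact Finset.prod_eq_zero (Finset.mem_univ j) (hy0 j s hj)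

/-- The product of the arrays `w t`, where `w t` depends on the coordinates `j` with `c j = t`. -/
noncomputable def glueTensor {J T : Type*} [Fintype J] [Fintype T] {n : J → ℕ} (c : J → T)
    (w : ∀ t, EuclideanSpace ℝ (∀ j : {j // c j = t}, Fin (n j))) :
    EuclideanSpace ℝ (∀ j, Fin (n j)) :=
  WithLp.toLp 2 fun i => ∏ t, w t fun j => i j

theorem sum_prod_fiberwise {J T : Type*} [Fintype J] [Fintype T] [DecidableEq J] [DecidableEq T]
    {n : J → ℕ} (c : J → T) (f : ∀ t, (∀ j : {j // c j = t}, Fin (n j)) → ℝ) :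
    ∑ i : ∀ j, Fin (n j), ∏ t, f t (fun j => i j) = ∏ t, ∑ i, f t i := by
  let e : (∀ j, Fin (n j)) ≃ ∀ t, ∀ j : {j // c j = t}, Fin (n j) :=
    { toFun := fun i t j => i j
      invFun := fun g j => g (c j) ⟨j, rfl⟩
      left_inv := fun i => rfl
      right_inv := fun g => by
        ext t ⟨j, rfl⟩
        rfl }
  rw [Finset.prod_univ_sum, Fintype.piFinset_univ, ← e.sum_comp]
  rfl

theorem norm_glueTensor {J T : Type*} [Fintype J] [Fintype T] [DecidableEq J] [DecidableEq T]
    {n : J → ℕ} (c : J → T) (w : ∀ t, EuclideanSpace ℝ (∀ j : {j // c j = t}, Fin (n j))) :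
    ‖glueTensor c w‖ = ∏ t, ‖w t‖ := by
  have h : ‖glueTensor c w‖ ^ 2 = (∏ t, ‖w t‖) ^ 2 := by
    rw [← Finset.prod_pow, EuclideanSpace.norm_sq_eq]
    simp only [EuclideanSpace.norm_sq_eq, glueTensor, Real.norm_eq_abs, sq_abs, ← Finset.prod_pow]
    exact sum_prod_fiberwise c fun t i => (w t i) ^ 2
  exact (sq_eq_sq₀ (norm_nonneg _) (Finset.prod_nonneg fun _ _ => norm_nonneg _)).1 h

theorem inner_glueTensor {J T : Type*} [Fintype J] [Fintype T] [DecidableEq J] [DecidableEq T]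
    {n : J → ℕ} (c : J → T) (w : ∀ t, EuclideanSpace ℝ (∀ j : {j // c j = t}, Fin (n j)))
    (u : ∀ j, EuclideanSpace ℝ (Fin (n j))) :
    ⟪glueTensor c w, elemTensor u⟫
      = ∏ t, ⟪w t, elemTensor fun j : {j // c j = t} => u j⟫ := by
  simp only [PiLp.inner_apply, elemTensor, glueTensor]
  rw [← sum_prod_fiberwise c fun t i => ⟪w t i, ∏ j : {j // c j = t}, u j (i j)⟫]
  refine Finset.sum_congr rfl fun i _ => ?_
  rw [← Fintype.prod_fiberwise c fun j => u j (i j)]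
  simp [Finset.prod_mul_distrib]

/-! ### Splitting the factors into three groups -/

theorem Finset.exists_sum_lt_le_sum_add {J : Type*} [DecidableEq J] (κ : J → ℕ) {N : ℕ} (hN : 0 < N)
    (t : Finset J) (h : N ≤ ∑ j ∈ t, κ j) :
    ∃ (s : Finset J) (j : J), j ∉ s ∧ ∑ i ∈ s, κ i < N ∧ N ≤ ∑ i ∈ s, κ i + κ j := by
  induction t using Finset.induction with
  | empty => simp at h; omega
  | insert a t ha ih =>
    by_cases ht : N ≤ ∑ j ∈ t, κ j
    · exact ih ht
    · refine ⟨t, a, ha, not_le.1 ht, ?_⟩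
      rw [Finset.sum_insert ha] at h
      omega

/-- One group is filled until the next factor j would bring its sum to R or more; j alone is the
second group and the rest the third. The first two sums are below R, so the cap leaves them
unchanged, and together they reach R. The bound therefore holds whether or not the third sum is
capped. -/
theorem exists_coloring {J : Type*} [Fintype J] [DecidableEq J] {R : ℕ} (hR : 0 < R) (κ : J → ℕ)
    (hκ : ∀ j, κ j + 1 ≤ R) (hsum : 2 * R ≤ ∑ j, κ j + 1) :
    ∃ c : J → Fin 3, 2 * R ≤ ∑ t, min (R - 1) (∑ j : {j // c j = t}, κ j) + 1 ∧
      ∀ t, min (R - 1) (∑ j : {j // c j = t}, κ j) ≤ min (R - 1) (∑ j : {j // c j = 0}, κ j) := by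
  obtain ⟨s, j, hj, hlt, hle⟩ := Finset.univ.exists_sum_lt_le_sum_add κ hR (by omega)
  have hex : ∃ c : J → Fin 3, 2 * R ≤ ∑ t, min (R - 1) (∑ j : {j // c j = t}, κ j) + 1 := by
    let c : J → Fin 3 := fun i => if i = j then 1 else if i ∈ s then 0 else 2
    have htot := Fintype.sum_fiberwise c κ
    rw [Fin.sum_univ_three] at htot
    have h0 : ∑ i : {i // c i = 0}, κ i = ∑ i ∈ s, κ i := by
      rw [← Finset.sum_subtype s]
      intro i
      by_cases hi : i = j
      · simp [c, hi, hj]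
      · by_cases his : i ∈ s <;> simp [c, hi, his]
    have h1 : ∑ i : {i // c i = 1}, κ i = κ j := by
      rw [← Finset.sum_subtype {j}]
      · simp
      · intro i
        by_cases hi : i = j
        · simp [c, hi]
        · by_cases his : i ∈ s <;> simp [c, hi, his]
    refine ⟨c, ?_⟩
    rw [Fin.sum_univ_three]
    have := hκ j
    omega
  obtain ⟨c, hc⟩ := hex
  -- A swap of colours moves the largest group to colour 0, the role of A.
  obtain ⟨m, -, hm⟩ := Finset.exists_max_image Finset.univ
    (fun t => min (R - 1) (∑ j : {j // c j = t}, κ j)) ⟨0, Finset.mem_univ _⟩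
  have hswap : ∀ t, ∑ j : {j // Equiv.swap 0 m (c j) = t}, κ j
      = ∑ j : {j // c j = Equiv.swap 0 m t}, κ j := by
    intro t
    refine Fintype.sum_equiv (Equiv.subtypeEquivRight fun i => ?_) _ _ fun i => rfl
    rw [← Equiv.eq_symm_apply, Equiv.symm_swap]
  refine ⟨fun i => Equiv.swap 0 m (c i), ?_, fun t => ?_⟩
  · simp only [hswap]
    rwa [Equiv.sum_comp (Equiv.swap 0 m) fun t => min (R - 1) (∑ j : {j // c j = t}, κ j)]
  · simp only [hswap]
    rw [Equiv.swap_apply_left]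
    exact hm _ (Finset.mem_univ _)

/-! ### Bounds for the parameters -/

theorem one_add_sum_le_prod_one_add {J : Type*} (s : Finset J) (κ : J → ℕ) :
    1 + ∑ j ∈ s, κ j ≤ ∏ j ∈ s, (1 + κ j) := by
  classical
  induction s using Finset.induction with
  | empty => simp
  | insert a s ha ih =>
    rw [Finset.sum_insert ha, Finset.prod_insert ha]
    nlinarith [Nat.zero_le (κ a), Nat.zero_le (∑ j ∈ s, κ j)]

theorem DualSep.le_dim {n R k : ℕ} {τ : ℝ} {u : Fin R → EuclideanSpace ℝ (Fin n)}
    (h : DualSep k τ u) (hkR : k ≤ R) : k ≤ n := by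
  by_contra hcon
  obtain ⟨T, -, hT⟩ := Finset.exists_subset_card_eq
    (show k ≤ (Finset.univ : Finset (Fin R)).card by simpa using hkR)
  obtain ⟨g, hg0, -, ⟨r, hr, hgr⟩, hg⟩ := exists_normalized_relation T
    (Finset.univ : Finset (Fin n)) (by simp; omega) (fun i s => u i s)
  have h1 := h.abs_coeff_le hT.le hg0 hr
  have h2 : ∑ i, g i • u i = 0 := by
    ext s
    simpa using hg s (Finset.mem_univ s)
  rw [h2, hgr, norm_zero, mul_zero, abs_one] at h1
  linarith

theorem prod_fiber_le {J T : Type*} [Fintype J] [DecidableEq T] (c : J → T) (t : T)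
    {f g : J → ℝ} (hf : ∀ j, 0 ≤ f j) (hfg : ∀ j, f j ≤ g j) (hg : ∀ j, 1 ≤ g j) :
    ∏ j : {j // c j = t}, f j ≤ ∏ j, g j := by
  classical
  have h1 : ∏ j : {j // c j = t}, f j = ∏ j, if c j = t then f j else 1 := by
    rw [← Finset.prod_filter, Finset.prod_subtype (p := fun j => c j = t)]
    simp
  rw [h1]
  refine Finset.prod_le_prod (fun j _ => ?_) fun j _ => ?_
  · split_ifs
    exacts [hf j, zero_le_one]
  · split_ifs
    exacts [hfg j, hg j]

/-! ### Factors of close rank-one tensors -/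

/-- Testing with u_j/‖u_j‖² in every slot gives scalars l_j of product near 1. Replacing slot j by
the part w of v_j orthogonal to u_j kills the u-term and leaves ‖w‖² ∏_{i≠j} |l_i|. That product is
at least 1/(2K), because |l_j| ≤ K, and so w is small. -/
theorem exists_scaling_of_prod_inner_close {J : Type*} [Fintype J] [DecidableEq J] {E : J → Type*}
    [∀ j, NormedAddCommGroup (E j)] [∀ j, InnerProductSpace ℝ (E j)] {u v : ∀ j, E j}
    {τ ρ : J → ℝ} {K δ : ℝ} (hδ : 0 ≤ δ) (hK : 1 ≤ K)
    (hτ : ∀ j, 1 ≤ τ j) (hτu : ∀ j, 1 ≤ τ j * ‖u j‖) (hv : ∀ j, ‖v j‖ ≤ ρ j)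
    (hτK : ∏ j, τ j ≤ K) (hρK : ∀ j, τ j * ρ j ≤ K) (hδK : 2 * (δ * K) ≤ 1)
    (h : ∀ y : ∀ j, E j, |∏ j, ⟪y j, v j⟫ - ∏ j, ⟪y j, u j⟫| ≤ δ * ∏ j, ‖y j‖) :
    ∃ l : J → ℝ, |∏ j, l j - 1| ≤ δ * K ∧ ∀ j, ‖v j - l j • u j‖ ≤ 2 * K ^ 2 * δ := by
  have hKpos : 0 < K := one_pos.trans_le hK
  have hu : ∀ j, 0 < ‖u j‖ := by
    intro j
    by_contra hcon
    have h0 : ‖u j‖ = 0 := le_antisymm (not_lt.1 hcon) (norm_nonneg _)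
    have := hτu j
    rw [h0, mul_zero] at this
    linarith
  let y : ∀ j, E j := fun j => (‖u j‖ ^ 2)⁻¹ • u j
  have hyu : ∀ j, ⟪y j, u j⟫ = 1 := by
    intro j
    have := hu j
    rw [real_inner_smul_left, real_inner_self_eq_norm_sq, inv_mul_cancel₀ (by positivity)]
  have hyn : ∀ j, ‖y j‖ ≤ τ j := by
    intro j
    have := hu j
    rw [norm_smul, norm_inv, norm_pow, norm_norm]
    have h1 : (‖u j‖ ^ 2)⁻¹ * ‖u j‖ = ‖u j‖⁻¹ := by field_simp
    rw [h1, inv_le_iff_one_le_mul₀ this]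
    exact hτu j
  have hprod : |∏ j, ⟪y j, v j⟫ - 1| ≤ δ * K := by
    have h1 := h y
    rw [Finset.prod_eq_one (f := fun j => ⟪y j, u j⟫) fun j _ => hyu j] at h1
    refine h1.trans (mul_le_mul_of_nonneg_left ?_ hδ)
    exact (Finset.prod_le_prod (fun _ _ => norm_nonneg _) fun j _ => hyn j).trans hτK
  refine ⟨fun j => ⟪y j, v j⟫, hprod, fun j => ?_⟩
  set w : E j := v j - ⟪y j, v j⟫ • u j with hw
  have hwu : ⟪w, u j⟫ = 0 := by
    have := hu j
    rw [hw, inner_sub_left, real_inner_smul_left, real_inner_self_eq_norm_sq,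
      real_inner_smul_left, real_inner_comm (u j)]
    field_simp
    ring
  have hwv : ⟪w, v j⟫ = ‖w‖ ^ 2 := by
    have h1 : v j = w + ⟪y j, v j⟫ • u j := by rw [hw]; abel
    nth_rewrite 1 [h1]
    rw [inner_add_right, inner_smul_right, hwu, mul_zero, add_zero, real_inner_self_eq_norm_sq]
  have h1 := h (Function.update y j w)
  rw [← Finset.mul_prod_erase _ _ (Finset.mem_univ j),
    ← Finset.mul_prod_erase _ (fun i => ⟪Function.update y j w i, u i⟫) (Finset.mem_univ j),
    ← Finset.mul_prod_erase _ (fun i => ‖Function.update y j w i‖) (Finset.mem_univ j)] at h1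
  simp only [Function.update_self, hwu, hwv, zero_mul, sub_zero] at h1
  have h2 : ∏ i ∈ Finset.univ.erase j, ⟪Function.update y j w i, v i⟫
      = ∏ i ∈ Finset.univ.erase j, ⟪y i, v i⟫ :=
    Finset.prod_congr rfl fun i hi => by
      rw [Function.update_of_ne (Finset.mem_erase.1 hi).1]
  have h3 : ∏ i ∈ Finset.univ.erase j, ‖Function.update y j w i‖ ≤ K := by
    calc _ ≤ ∏ i ∈ Finset.univ.erase j, τ i := by
          refine Finset.prod_le_prod (fun _ _ => norm_nonneg _) fun i hi => ?_
          rw [Function.update_of_ne (Finset.mem_erase.1 hi).1]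
          exact hyn i
      _ ≤ τ j * ∏ i ∈ Finset.univ.erase j, τ i :=
          le_mul_of_one_le_left (Finset.prod_nonneg fun i _ => zero_le_one.trans (hτ i)) (hτ j)
      _ = ∏ i, τ i := Finset.mul_prod_erase _ _ (Finset.mem_univ j)
      _ ≤ K := hτK
  rw [h2, abs_mul, abs_of_nonneg (sq_nonneg _)] at h1
  set P := |∏ i ∈ Finset.univ.erase j, ⟪y i, v i⟫| with hP
  have h4 : 1 ≤ 2 * K * P := by
    have e1 : |∏ i, ⟪y i, v i⟫| = |⟪y j, v j⟫| * P := by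
      rw [hP, ← abs_mul, Finset.mul_prod_erase _ (fun i => ⟪y i, v i⟫) (Finset.mem_univ j)]
    have e2 : |⟪y j, v j⟫| ≤ K := by
      refine (abs_real_inner_le_norm _ _).trans (le_trans ?_ (hρK j))
      exact mul_le_mul (hyn j) (hv j) (norm_nonneg _) (zero_le_one.trans (hτ j))
    have e3 : 1 - δ * K ≤ |∏ i, ⟪y i, v i⟫| := by
      have := (abs_le.1 hprod).1
      exact le_trans (by linarith) (le_abs_self _)
    have e4 : |⟪y j, v j⟫| * P ≤ K * P := mul_le_mul_of_nonneg_right e2 (abs_nonneg _)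
    linarith
  rcases (norm_nonneg w).eq_or_lt with h0 | h0
  · rw [← h0]; positivity
  · have h5 : ‖w‖ * P ≤ δ * K := by
      have e1 : (‖w‖ * P) * ‖w‖ ≤ (δ * K) * ‖w‖ := by
        calc (‖w‖ * P) * ‖w‖ = ‖w‖ ^ 2 * P := by ring
          _ ≤ δ * (‖w‖ * ∏ i ∈ Finset.univ.erase j, ‖Function.update y j w i‖) := h1
          _ ≤ δ * (‖w‖ * K) := by gcongr
          _ = _ := by ring
      exact le_of_mul_le_mul_right e1 h0
    calc ‖w‖ ≤ (2 * K * P) * ‖w‖ := le_mul_of_one_le_left (norm_nonneg _) h4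
      _ = 2 * K * (‖w‖ * P) := by ring
      _ ≤ 2 * K * (δ * K) := by gcongr
      _ = _ := by ring

/-! ### Matrices, columns and the proof of the theorem -/

theorem Matrix.frobenius_norm_le_of_col {m n : Type*} [Fintype m] [Fintype n] (M : Matrix m n ℝ)
    {δ : ℝ} (h : ∀ p, ‖WithLp.toLp 2 (M.col p)‖ ≤ δ) : ‖M‖ ≤ Fintype.card n * δ := by
  rcases isEmpty_or_nonempty n with hn | ⟨⟨p₀⟩⟩
  · have : M = 0 := by ext i p; exact hn.elim p
    simp [this]
  have hδ : 0 ≤ δ := (norm_nonneg _).trans (h p₀)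
  have h1 : ‖M‖ ^ 2 = ∑ p, ‖WithLp.toLp 2 (M.col p)‖ ^ 2 := by
    rw [Matrix.frobenius_norm_def, ← Real.sqrt_eq_rpow, Real.sq_sqrt (by positivity),
      Finset.sum_comm]
    refine Finset.sum_congr rfl fun p _ => ?_
    rw [EuclideanSpace.norm_sq_eq]
    simp [Matrix.col]
  refine le_of_sq_le_sq ?_ (by positivity)
  rw [h1]
  refine (Finset.sum_le_card_nsmul _ _ (δ ^ 2)
    fun p _ => pow_le_pow_left₀ (norm_nonneg _) (h p) 2).trans ?_
  rw [nsmul_eq_mul, mul_pow, Finset.card_univ]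
  refine mul_le_mul_of_nonneg_right ?_ (sq_nonneg _)
  have : (1 : ℝ) ≤ Fintype.card n := by exact_mod_cast Fintype.card_pos_iff.2 ⟨p₀⟩
  nlinarith

theorem prod_ofFn_diagonal {ℓ R : ℕ} (Λ : Fin ℓ → Fin R → ℝ) :
    (List.ofFn fun j => Matrix.diagonal (Λ j)).prod = Matrix.diagonal fun p => ∏ j, Λ j p := by
  have h1 : (List.ofFn fun j => Matrix.diagonal (Λ j))
      = (List.ofFn Λ).map (Matrix.diagonalRingHom (Fin R) ℝ) := by
    rw [List.map_ofFn]; rfl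
  rw [h1, ← map_list_prod, List.prod_ofFn]
  exact congrArg Matrix.diagonal (funext fun p => Finset.prod_apply _ _ _)

theorem cpTensor_eq_sum {ℓ R : ℕ} {n : Fin ℓ → ℕ} (U : ∀ j, Matrix (Fin (n j)) (Fin R) ℝ) :
    cpTensor U = ∑ r, elemTensor fun j => WithLp.toLp 2 ((U j).col r) := by
  ext i
  simp [cpTensor, elemTensor, Matrix.col]

theorem inner_glueTensor_cpTensor {ℓ R : ℕ} {n : Fin ℓ → ℕ} {c : Fin ℓ → Fin 3}
    (U : ∀ j, Matrix (Fin (n j)) (Fin R) ℝ)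
    (w : ∀ t, EuclideanSpace ℝ (∀ j : {j // c j = t}, Fin (n j))) :
    ⟪glueTensor c w, cpTensor U⟫ = ∑ r,
      ⟪w 0, elemTensor fun j : {j // c j = 0} => WithLp.toLp 2 ((U j).col r)⟫ *
      ⟪w 1, elemTensor fun j : {j // c j = 1} => WithLp.toLp 2 ((U j).col r)⟫ *
      ⟪w 2, elemTensor fun j : {j // c j = 2} => WithLp.toLp 2 ((U j).col r)⟫ := by
  rw [cpTensor_eq_sum, inner_sum]
  refine Finset.sum_congr rfl fun r _ => ?_
  rw [inner_glueTensor, Fin.prod_univ_three]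

theorem exists_pi_fin_three {α : Fin 3 → Type*} (x : α 0) (y : α 1) (z : α 2) :
    ∃ w : ∀ t, α t, w 0 = x ∧ w 1 = y ∧ w 2 = z :=
  ⟨fun | 0 => x | 1 => y | 2 => z, rfl, rfl, rfl⟩

/-- Gluing test tensors of the three groups turns the Frobenius bound into the trilinear one.
Elementary test tensors then turn the grouped terms back into products over all j. -/
theorem exists_perm_prod_inner_close {ℓ R : ℕ} {n k : Fin ℓ → ℕ} {τ ρ ρ' : Fin ℓ → ℝ} {K ε : ℝ}
    {U V : ∀ j, Matrix (Fin (n j)) (Fin R) ℝ} (hR : 0 < R) (hkR : ∀ j, k j ≤ R)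
    (hτ : ∀ j, 0 ≤ τ j) (hρ : ∀ j, 0 ≤ ρ j) (hρ' : ∀ j, 0 ≤ ρ' j) {g : Fin ℓ → ℝ}
    (hg : ∀ j, 1 ≤ g j) (hτg : ∀ j, τ j ≤ g j) (hρg : ∀ j, ρ j ≤ g j) (hρ'g : ∀ j, ρ' j ≤ g j)
    (hgK : ∏ j, g j ≤ K) (hRK : (R : ℝ) ≤ K) (hε : 0 ≤ ε) (hsmall : 84 * ε * K ^ 22 < 1)
    (hU : ∀ j, ColBounded (ρ j) (U j)) (hV : ∀ j, ColBounded (ρ' j) (V j))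
    (hsep : ∀ j, DualSep (k j) (τ j)
      (fun r => (WithLp.toLp 2 ((U j).col r) : EuclideanSpace ℝ (Fin (n j)))))
    (hk : ∀ j, 1 ≤ k j) (hsum : 2 * R ≤ ∑ j, (k j - 1) + 1)
    (hclose : TensorClose ε (cpTensor U) (cpTensor V)) :
    ∃ π : Equiv.Perm (Fin R), ∀ p (y : ∀ j, EuclideanSpace ℝ (Fin (n j))),
      |∏ j, ⟪y j, WithLp.toLp 2 ((V j).col p)⟫ - ∏ j, ⟪y j, WithLp.toLp 2 ((U j).col (π p))⟫|
        ≤ 84 * (ε * K ^ 22) * ∏ j, ‖y j‖ := by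
  obtain ⟨c, hc, hcmax⟩ := exists_coloring hR (fun j => k j - 1)
    (fun j => by have := hkR j; have := hk j; omega) hsum
  rw [Fin.sum_univ_three] at hc
  let A : ∀ t, Fin R → EuclideanSpace ℝ (∀ j : {j // c j = t}, Fin (n j)) :=
    fun t r => elemTensor fun j => WithLp.toLp 2 ((U j).col r)
  let A' : ∀ t, Fin R → EuclideanSpace ℝ (∀ j : {j // c j = t}, Fin (n j)) :=
    fun t r => elemTensor fun j => WithLp.toLp 2 ((V j).col r)
  have hA : ∀ t r, ‖A t r‖ ≤ K := by
    intro t r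
    rw [norm_elemTensor]
    refine le_trans ?_ ((prod_fiber_le c t hρ hρg hg).trans hgK)
    exact Finset.prod_le_prod (fun _ _ => norm_nonneg _) fun j _ => hU j r
  have hA' : ∀ t r, ‖A' t r‖ ≤ K := by
    intro t r
    rw [norm_elemTensor]
    refine le_trans ?_ ((prod_fiber_le c t hρ' hρ'g hg).trans hgK)
    exact Finset.prod_le_prod (fun _ _ => norm_nonneg _) fun j _ => hV j r
  -- The cap at R - 1 keeps each rank at most R, as the three-factor argument requires.
  have hS : ∀ t, DualSep (1 + min (R - 1) (∑ j : {j // c j = t}, (k j - 1))) K (A t) := by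
    intro t
    refine (DualSep.elemTensor (J := {j // c j = t}) (fun j => hsep j) fun j => hk j).mono
      (by omega) ((prod_fiber_le c t hτ hτg hg).trans hgK)
  have hone : 1 ≤ K := by
    refine le_trans ?_ hRK
    exact_mod_cast hR
  have hKC : KruskalClose K ε _ _ _ (A 0) (A' 0) (A 1) (A' 1) (A 2) (A' 2) :=
    { one_le := hone
      R_le := hRK
      eps_nonneg := hε
      small := hsmall
      sepA := hS 0
      sepB := hS 1
      sepC := hS 2
      normA := hA 0
      normB := hA 1
      normC := hA 2
      normA' := hA' 0
      normB' := hA' 1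
      normC' := hA' 2
      a_le := by omega
      b_le := by have := hcmax 1; omega
      c_le := by have := hcmax 2; omega
      sum_ge := by omega
      close := by
        intro x y z
        obtain ⟨w, rfl, rfl, rfl⟩ := exists_pi_fin_three
          (α := fun t => EuclideanSpace ℝ (∀ j : {j // c j = t}, Fin (n j))) x y z
        have h1 := abs_real_inner_le_norm (glueTensor c w) (cpTensor U - cpTensor V)
        rw [inner_sub_right, inner_glueTensor_cpTensor, inner_glueTensor_cpTensor,
          norm_glueTensor, Fin.prod_univ_three] at h1
        refine h1.trans ?_
        rw [mul_comm]
        exact mul_le_mul_of_nonneg_right hclose (by positivity) }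
  obtain ⟨π, hπ⟩ := hKC.exists_perm_term_close
  refine ⟨π, fun p y => ?_⟩
  have h1 := hπ p (elemTensor fun j => y j) (elemTensor fun j => y j) (elemTensor fun j => y j)
  simp only [A, A', inner_elemTensor, norm_elemTensor] at h1
  rwa [← Fin.prod_univ_three fun t => ∏ j : {j // c j = t}, ⟪y j, WithLp.toLp 2 ((V j).col p)⟫,
    ← Fin.prod_univ_three fun t => ∏ j : {j // c j = t}, ⟪y j, WithLp.toLp 2 ((U j).col (π p))⟫,
    ← Fin.prod_univ_three fun t => ∏ j : {j // c j = t}, ‖y j‖,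
    Fintype.prod_fiberwise c fun j => ⟪y j, WithLp.toLp 2 ((V j).col p)⟫,
    Fintype.prod_fiberwise c fun j => ⟪y j, WithLp.toLp 2 ((U j).col (π p))⟫,
    Fintype.prod_fiberwise c fun j => ‖y j‖] at h1

theorem col_sub_mul_permMatrix_mul_diagonal {m R : ℕ} (V U : Matrix (Fin m) (Fin R) ℝ)
    (π : Equiv.Perm (Fin R)) (l : Fin R → ℝ) (p : Fin R) :
    (WithLp.toLp 2 ((V - U * (π⁻¹).permMatrix ℝ * Matrix.diagonal l).col p) :
      EuclideanSpace ℝ (Fin m))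
      = WithLp.toLp 2 (V.col p) - l p • WithLp.toLp 2 (U.col (π p)) := by
  ext i
  simp [Matrix.col, Equiv.Perm.permMatrix, PEquiv.mul_toMatrix_toPEquiv, mul_comm]
  exact Or.inl rfl

theorem theorem2p2 :
    ∃ C : ℕ, ∀ (ℓ R : ℕ) (n : Fin ℓ → ℕ) (τ ρ ρ' : Fin ℓ → ℝ) (k : Fin ℓ → ℕ)
      (U : ∀ j, Matrix (Fin (n j)) (Fin R) ℝ),
      ℓ ≤ R →
      (∀ j, 1 ≤ τ j) → (∀ j, 1 ≤ ρ j) → (∀ j, 1 ≤ ρ' j) →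
      (∀ j, ColBounded (ρ j) (U j)) →
      (∀ j, robustKruskalRank (τ j) (U j) = k j) →
      (∀ j, 2 ≤ k j) →
      2 * (R : ℤ) + ℓ - 1 ≤ ∑ j, (k j : ℤ) →
      ∀ ε' : ℝ, 0 < ε' → ε' < 1 →
        ∀ V : ∀ j, Matrix (Fin (n j)) (Fin R) ℝ,
          (∀ j, ColBounded (ρ' j) (V j)) →
          TensorClose
            ((ε' / R) ^ (2 ^ ℓ) * (∏ j, (τ j * ρ j * ρ' j * n j) ^ C)⁻¹)
            (cpTensor U) (cpTensor V) →
          ∃ (π : Equiv.Perm (Fin R)) (Λ : Fin ℓ → Fin R → ℝ),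
            ‖(List.ofFn fun j => Matrix.diagonal (Λ j)).prod - 1‖ ≤ ε' ∧
            ∀ j, ‖V j - U j * π.permMatrix ℝ * Matrix.diagonal (Λ j)‖ ≤ ε' := by
  -- The final error is 168εK²⁵, and 168 ≤ 2⁸ ≤ K⁸.
  refine ⟨33, ?_⟩
  intro ℓ R n τ ρ ρ' k U hℓR hτ hρ hρ' hU hk hk2 hsum ε' hε' hε'1 V hV hclose
  rcases Nat.eq_zero_or_pos R with rfl | hR
  · have hℓ : ℓ = 0 := by omega
    subst hℓ
    refine ⟨1, fun _ _ => 0, ?_, fun j => j.elim0⟩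
    rw [Subsingleton.elim ((List.ofFn _).prod - 1 : Matrix (Fin 0) (Fin 0) ℝ) 0, norm_zero]
    exact hε'.le
  have hτ0 : ∀ j, 0 < τ j := fun j => one_pos.trans_le (hτ j)
  have hk1 : ∀ j, 1 ≤ k j := fun j => (hk2 j).trans' one_le_two
  have hsep := fun j => dualSep_of_robustKruskalRank (hτ0 j) (hk j) (hk1 j)
  have hkR : ∀ j, k j ≤ R := fun j => (le_card_of_robustKruskalRank (hk j) (hk1 j)).1
  have hkn : ∀ j, k j ≤ n j := fun j => (hsep j).le_dim (hkR j)
  have hn1 : ∀ j, (1 : ℝ) ≤ n j := fun j => by exact_mod_cast (hk1 j).trans (hkn j)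
  have hsum' : 2 * R ≤ ∑ j, (k j - 1) + 1 := by
    have h1 : ∑ j, (k j : ℤ) = ∑ j, ((k j - 1 : ℕ) : ℤ) + ℓ := by
      have : ∀ j, (k j : ℤ) = ((k j - 1 : ℕ) : ℤ) + 1 := fun j => by have := hk1 j; omega
      rw [Finset.sum_congr rfl fun j _ => this j, Finset.sum_add_distrib]
      simp
    have h2 : ((∑ j, (k j - 1) : ℕ) : ℤ) = ∑ j, ((k j - 1 : ℕ) : ℤ) := by push_cast; rfl
    omega
  obtain ⟨g, hg⟩ : ∃ g : Fin ℓ → ℝ, ∀ j, g j = τ j * ρ j * ρ' j * n j := ⟨_, fun _ => rfl⟩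
  obtain ⟨K, hK⟩ : ∃ K : ℝ, K = ∏ j, g j := ⟨_, rfl⟩
  simp only [← hg] at hclose
  have hmul : ∀ {x y : ℝ}, 1 ≤ x → 1 ≤ y → 1 ≤ x * y := fun hx hy =>
    one_le_mul_of_one_le_of_one_le hx hy
  have hle : ∀ {s x y : ℝ}, 1 ≤ x → 1 ≤ y → s ≤ x → s ≤ x * y := fun hx hy hs =>
    hs.trans (le_mul_of_one_le_right (zero_le_one.trans hx) hy)
  have h2 : ∀ j, 1 ≤ τ j * ρ j := fun j => hmul (hτ j) (hρ j)
  have h3 : ∀ j, 1 ≤ τ j * ρ j * ρ' j := fun j => hmul (h2 j) (hρ' j)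
  have hg1 : ∀ j, 1 ≤ g j := fun j => hg j ▸ hmul (h3 j) (hn1 j)
  have hτg : ∀ j, τ j ≤ g j := fun j => hg j ▸
    hle (h3 j) (hn1 j) (hle (h2 j) (hρ' j) (hle (hτ j) (hρ j) le_rfl))
  have hρg : ∀ j, ρ j ≤ g j := fun j => hg j ▸
    hle (h3 j) (hn1 j) (hle (h2 j) (hρ' j)
      (le_mul_of_one_le_left (zero_le_one.trans (hρ j)) (hτ j)))
  have hτρ'g : ∀ j, τ j * ρ' j ≤ g j := fun j => by
    rw [hg]
    refine hle (h3 j) (hn1 j) ?_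
    rw [mul_right_comm]
    exact le_mul_of_one_le_right (mul_nonneg (hτ0 j).le (zero_le_one.trans (hρ' j))) (hρ j)
  have hρ'g : ∀ j, ρ' j ≤ g j := fun j =>
    (le_mul_of_one_le_left (zero_le_one.trans (hρ' j)) (hτ j)).trans (hτρ'g j)
  have hng : ∀ j, (n j : ℝ) ≤ g j := fun j => hg j ▸
    le_mul_of_one_le_left (zero_le_one.trans (hn1 j)) (h3 j)
  -- Since n_j ≥ k_j, the product of the n_j is at least ∏ k_j ≥ 1 + ∑ (k_j - 1) ≥ 2R.
  have hK2R : 2 * (R : ℝ) ≤ K := by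
    have e1 : 2 * R ≤ ∏ j, n j := by
      have := one_add_sum_le_prod_one_add Finset.univ fun j => k j - 1
      refine (hsum'.trans (by omega)).trans (this.trans (Finset.prod_le_prod' fun j _ => ?_))
      have := hk1 j
      have := hkn j
      omega
    calc 2 * (R : ℝ) ≤ ((∏ j, n j : ℕ) : ℝ) := by exact_mod_cast e1
      _ = ∏ j, (n j : ℝ) := by push_cast; rfl
      _ ≤ K := hK ▸ Finset.prod_le_prod (fun j _ => zero_le_one.trans (hn1 j)) fun j _ => hng j
  have hR1 : (1 : ℝ) ≤ R := by exact_mod_cast hR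
  have hRK : (R : ℝ) ≤ K := by linarith
  have hK2 : 2 ≤ K := by linarith
  have hK1 : 1 ≤ K := by linarith
  have hKpos : 0 < K := by linarith
  obtain ⟨ε, hε⟩ : ∃ ε : ℝ, ε = (ε' / R) ^ (2 ^ ℓ) * (∏ j, g j ^ 33)⁻¹ := ⟨_, rfl⟩
  rw [← hε] at hclose
  have hε0 : 0 ≤ ε := by
    rw [hε, Finset.prod_pow, ← hK]
    positivity
  have hεK : ε * K ^ 33 ≤ ε' := by
    rw [hε, Finset.prod_pow, ← hK, inv_mul_cancel_right₀ (by positivity)]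
    have e1 : ε' / R ≤ ε' := div_le_self hε'.le hR1
    -- As ε'/R ≤ 1, a positive exponent is enough here.
    exact (pow_le_of_le_one (by positivity) (e1.trans hε'1.le) (by positivity)).trans e1
  have hεK' : 168 * (ε * K ^ 25) ≤ ε' := by
    refine le_trans ?_ hεK
    have e1 : (168 : ℝ) ≤ K ^ 8 := by
      have : (2 : ℝ) ^ 8 ≤ K ^ 8 := pow_le_pow_left₀ (by norm_num) hK2 8
      norm_num at this
      linarith
    calc 168 * (ε * K ^ 25) ≤ K ^ 8 * (ε * K ^ 25) := by gcongr
      _ = _ := by ring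
  have hpow : ∀ {m : ℕ}, m ≤ 25 → ε * K ^ m ≤ ε * K ^ 25 := fun hm =>
    mul_le_mul_of_nonneg_left (pow_le_pow_right₀ hK1 hm) hε0
  have hp22 := hpow (m := 22) (by norm_num)
  have hp23 := hpow (m := 23) (by norm_num)
  have hp24 := hpow (m := 24) (by norm_num)
  have h25 : 0 ≤ ε * K ^ 25 := by positivity
  obtain ⟨π, hπ⟩ := exists_perm_prod_inner_close (K := K) (ε := ε) (g := g) hR hkR
    (fun j => (hτ0 j).le) (fun j => zero_le_one.trans (hρ j)) (fun j => zero_le_one.trans (hρ' j))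
    hg1 hτg hρg hρ'g hK.ge hRK hε0 (by rw [mul_assoc]; linarith) hU hV hsep hk1 hsum' hclose
  obtain ⟨δ, hδ⟩ : ∃ δ : ℝ, δ = 84 * (ε * K ^ 22) := ⟨_, rfl⟩
  rw [← hδ] at hπ
  have hδ0 : 0 ≤ δ := by rw [hδ]; positivity
  have hgK : ∀ j, g j ≤ K := fun j => by
    rw [hK, ← Finset.mul_prod_erase _ _ (Finset.mem_univ j)]
    refine le_mul_of_one_le_right (zero_le_one.trans (hg1 j)) ?_
    rw [← Finset.prod_const_one (s := Finset.univ.erase j)]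
    exact Finset.prod_le_prod (fun _ _ => zero_le_one) fun i _ => hg1 i
  have hscale := fun p => exists_scaling_of_prod_inner_close
    (u := fun j => (WithLp.toLp 2 ((U j).col (π p)) : EuclideanSpace ℝ (Fin (n j))))
    (v := fun j => (WithLp.toLp 2 ((V j).col p) : EuclideanSpace ℝ (Fin (n j))))
    (ρ := ρ') hδ0 hK1 hτ
    (fun j => by
      obtain ⟨y, hy, hy1, -⟩ := hsep j (π p) ∅ (by simp) (by rw [Finset.card_empty]; exact hk1 j)
      rw [← hy1]
      exact (real_inner_le_norm _ _).trans (mul_le_mul_of_nonneg_right hy (norm_nonneg _)))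
    (fun j => hV j p)
    (hK ▸ Finset.prod_le_prod (fun j _ => (hτ0 j).le) fun j _ => hτg j)
    (fun j => (hτρ'g j).trans (hgK j))
    (by
      have : 2 * (δ * K) = 168 * (ε * K ^ 23) := by rw [hδ]; ring
      linarith)
    (hπ p)
  choose l hl1 hl2 using hscale
  -- With the convention of `permMatrix`, multiplying by the matrix of π⁻¹ on the right makes column
  -- `π p` of U the new column p.
  refine ⟨π⁻¹, fun j p => l p j, ?_, fun j => ?_⟩
  · rw [prod_ofFn_diagonal, ← Matrix.diagonal_one, Matrix.diagonal_sub]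
    refine (Matrix.frobenius_norm_le_of_col _ (δ := δ * K) fun p => ?_).trans ?_
    · have : (Matrix.diagonal fun p => ∏ j, l p j - 1).col p
          = Pi.single p (∏ j, l p j - 1) := by
        ext i
        by_cases hi : i = p
        · subst hi; simp [Matrix.col]
        · simp [Matrix.col, hi]
      rw [this]
      simpa using hl1 p
    · rw [Fintype.card_fin]
      calc (R : ℝ) * (δ * K) ≤ K * (δ * K) := by gcongr
        _ = 84 * (ε * K ^ 24) := by rw [hδ]; ring
        _ ≤ ε' := by linarith
  · refine (Matrix.frobenius_norm_le_of_col _ (δ := 2 * K ^ 2 * δ) fun p => ?_).trans ?_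
    · rw [col_sub_mul_permMatrix_mul_diagonal]
      exact hl2 p j
    · rw [Fintype.card_fin]
      calc (R : ℝ) * (2 * K ^ 2 * δ) ≤ K * (2 * K ^ 2 * δ) := by gcongr
        _ = 168 * (ε * K ^ 25) := by rw [hδ]; ring
        _ ≤ ε' := hεK'
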